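/- Let $q^{1/4}$ be an indeterminate and work over the field $\mathbb{Q}(q^{1/4})$. Put $[k]=\dfrac{q^{k/2}-q^{-k/2}}{q^{1/2}-q^{-1/2}}$, $(q;q)_k=\prod_{l=1}^{k}(1-q^l)$, and $\binom{n}{k}_q=\dfrac{(q;q)_n}{(q;q)_k(q;q)_{n-k}}$ for $0\le k\le n$. For a disk with $m$ marked points on its boundary let $W_m$ be the vector space with basis the boundary-fixing isotopy classes of crossingless systems of disjoint embedded arcs without closed components whose set of endpoints is exactly the set of marked points (for $m=0$, the only basis element is the empty disk $\emptyset$). The Kauffman bracket $\langle\,\cdot\,\rangle_2$ of a tangle diagram in the disk is the element of $W_m$ determined by two local rules: a trivial loop is replaced by the factor $-[2]$, and a crossing in which the strand from the upper left to the lower right is over equals $q^{1/4}$ times two horizontal strands plus $q^{-1/4}$ times two turnbacks (one arc joining the two left ends and one arc joining the two right ends). Webs are written with left and right marked points; gluing side by side and placing one above the other are extended bilinearly, closed loops being replaced by $-[2]$. The clasps (Jones--Wenzl projectors) $P_n\in W_{n+n}$ are defined as follows: $P_0$ is the empty web, $P_1$ is one strand, and for $n\ge 2$ $$P_n=(P_{n-1}\otimes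 1)+\frac{[n-1]}{[n]}\,(P_{n-1}\otimes 1)\,e_{n-1}\,(P_{n-1}\otimes 1),$$ where $\otimes$ places the first web above the second, and $e_{n-1}$ consists of $n-2$ horizontal strands at the top and, at the last two places, one turnback on the left and one on the right. Then for every integer $n\ge 0$: (1) Let $X_n$ be the crossing of two bundles of $n$ parallel strands, in which the bundle from the upper left to the lower right passes over the other, and for $0\le k\le n$ let $Y_{n,k}$ be the crossingless diagram with $n+n$ left and $n+n$ right ends which has $k$ horizontal strands at the top, $k$ horizontal strands at the bottom, and between them $n-k$ nested turnbacks on the left and $n-k$ nested turnbacks on the right. Then in $W_{4n}$ $$(P_n\otimes P_n)\,\langle X_n\rangle_2\,(P_n\otimes P_n)=\sum_{k=0}^{n}q^{\frac{-n^2+2k^2}{4}}\binom{n}{k}_q\,(P_n\otimes P_n)\,\langle Y_{n,k}\rangle_2\,(P_n\otimes P_n).$$ (2) The loop colored by $n$, that is, the closure of $P_n$ by $n$ parallel strands, equals $(-1)^n[n+1]\,\emptyset$ in $W_0$. -/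

import Mathlib

noncomputable section

namespace A1Web

/-! ### Scalars and quantum integers -/

/-- The field `ℚ(q^{1/4})` of rational functions in one variable `q^{1/4}`. -/
abbrev K : Type := RatFunc ℚ

/-- The variable `t = q^{1/4}`; thus `q^{j/4} = t ^ j` for every integer `j`. -/
def t : K := RatFunc.X

/-- `q = t ^ 4`. -/
def q : K := t ^ 4

/-- `{k} = q^{k/2} - q^{-k/2}`. -/
def qBrace (k : ℤ) : K := t ^ (2 * k) - t ^ (-(2 * k))

/-- The quantum integer `[k] = {k} / {1}`. -/
def qInt (k : ℤ) : K := qBrace k / qBrace 1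

/-- The `q`-Pochhammer symbol `(q; q)_k = ∏_{l=1}^k (1 - q^l)`. -/
def qPoch (k : ℕ) : K := ∏ l ∈ Finset.Icc 1 k, (1 - q ^ l)

/-- The `q`-binomial coefficient `(q;q)_n / ((q;q)_k (q;q)_{n-k})`, and `0` for `k > n`. -/
def qBinom (n k : ℕ) : K :=
  if k ≤ n then qPoch n / (qPoch k * qPoch (n - k)) else 0

/-! ### Basis webs

The disk is drawn as a rectangle with `m` marked points on its left side and `n` marked points on
its right side, each side numbered from top to bottom. -/

/-- The place of a marked point when the boundary of the disk is traversed counterclockwise from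
its upper left corner: down the left side, then up the right side. -/
def bdryPos {m n : ℕ} : Fin m ⊕ Fin n → ℕ
  | Sum.inl i => i
  | Sum.inr j => m + (n - 1 - j)

/-- An `A₁` basis web on the disk with `m` left and `n` right marked points. A boundary-fixing
isotopy class of disjoint embedded arcs with these endpoints is the same as a way of pairing the
marked points such that no two pairs interleave on the boundary circle. The arc at `x` ends
at `partner x`. -/
@[ext]
structure BasisWeb (m n : ℕ) where
  partner : Fin m ⊕ Fin n → Fin m ⊕ Fin n
  partner_partner : ∀ x, partner (partner x) = x
  partner_ne : ∀ x, partner x ≠ x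
  noncrossing : ∀ x y, ¬ (bdryPos x < bdryPos y ∧ bdryPos y < bdryPos (partner x) ∧
    bdryPos (partner x) < bdryPos (partner y))

instance (m n : ℕ) : Finite (BasisWeb m n) :=
  Finite.of_injective BasisWeb.partner fun _ _ h => BasisWeb.ext h

/-- The `A₁` web space: the `ℚ(q^{1/4})`-vector space with basis the basis webs. -/
abbrev W (m n : ℕ) : Type := BasisWeb m n →₀ K

/-- `n` parallel horizontal strands. (The two sides may carry two expressions `m`, `n` for the
same number.) -/
def strandsWeb {m n : ℕ} (h : m = n) : BasisWeb m n where
  partner := Sum.elim (fun i => Sum.inr (Fin.cast h i)) (fun j => Sum.inl (Fin.cast h.symm j))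
  partner_partner := by rintro (i | j) <;> simp
  partner_ne := by rintro (i | j) <;> simp
  noncrossing := by
    subst h
    rintro (i | i) (j | j) <;> simp [bdryPos] <;> omega

/-- A single arc with both ends on the right side. -/
def cupWeb : BasisWeb 0 2 where
  partner := Sum.map id Fin.rev
  partner_partner := by rintro (i | j) <;> simp
  partner_ne := by decide
  noncrossing := by
    rintro (i | i) (j | j)
    · exact i.elim0
    · exact i.elim0
    · exact j.elim0
    · simp [bdryPos]; omega

/-- A single arc with both ends on the left side. -/
def capWeb : BasisWeb 2 0 where
  partner := Sum.map Fin.rev id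
  partner_partner := by rintro (i | j) <;> simp
  partner_ne := by decide
  noncrossing := by
    rintro (i | i) (j | j)
    · simp [bdryPos]; omega
    · exact j.elim0
    · exact i.elim0
    · exact i.elim0

/-! ### Placing webs on top of each other -/

/-- The marked points of two disks, the first placed above the second. -/
def stackEquiv (m n m' n' : ℕ) :
    (Fin m ⊕ Fin n) ⊕ (Fin m' ⊕ Fin n') ≃ Fin (m + m') ⊕ Fin (n + n') :=
  (Equiv.sumSumSumComm _ _ _ _).trans (Equiv.sumCongr finSumFinEquiv finSumFinEquiv)

/-- The disjoint union of `w` and `v`, with `w` above `v`. -/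
def stackWeb {m n m' n' : ℕ} (w : BasisWeb m n) (v : BasisWeb m' n') :
    BasisWeb (m + m') (n + n') where
  partner := fun x =>
    stackEquiv m n m' n' (Sum.map w.partner v.partner ((stackEquiv m n m' n').symm x))
  partner_partner := by
    intro x
    obtain ⟨x, rfl⟩ := (stackEquiv m n m' n').surjective x
    rcases x with x | x <;> simp [w.partner_partner, v.partner_partner]
  partner_ne := by
    intro x
    obtain ⟨x, rfl⟩ := (stackEquiv m n m' n').surjective x
    rcases x with x | x <;> simp [w.partner_ne, v.partner_ne]
  noncrossing := by
    intro x y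
    obtain ⟨x, rfl⟩ := (stackEquiv m n m' n').surjective x
    obtain ⟨y, rfl⟩ := (stackEquiv m n m' n').surjective y
    have up : ∀ z : Fin m ⊕ Fin n,
        (bdryPos z < m ∧ bdryPos (stackEquiv m n m' n' (Sum.inl z)) = bdryPos z) ∨
        (m ≤ bdryPos z ∧ bdryPos (stackEquiv m n m' n' (Sum.inl z)) = bdryPos z + m' + n') := by
      rintro (i | j) <;> simp [stackEquiv, bdryPos] <;> omega
    have down : ∀ z : Fin m' ⊕ Fin n',
        bdryPos z < m' + n' ∧ bdryPos (stackEquiv m n m' n' (Sum.inr z)) = bdryPos z + m := by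
      rintro (i | j) <;> simp [stackEquiv, bdryPos] <;> omega
    rcases x with x | x <;> rcases y with y | y <;> simp only [Equiv.symm_apply_apply, Sum.map_inl,
      Sum.map_inr]
    · have := w.noncrossing x y
      have := up x; have := up y; have := up (w.partner x); have := up (w.partner y)
      omega
    · have := up x; have := down y; have := up (w.partner x); have := down (v.partner y)
      omega
    · have := down x; have := up y; have := down (v.partner x); have := up (w.partner y)
      omega
    · have := v.noncrossing x y
      have := down x; have := down y; have := down (v.partner x); have := down (v.partner y)
      omega

/-- Bilinear extension of `stackWeb` to web spaces. -/
def stack {m n m' n' : ℕ} : W m n →ₗ[K] W m' n' →ₗ[K] W (m + m') (n + n') :=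
  Finsupp.lift _ K _ fun w => Finsupp.lift _ K _ fun v => Finsupp.single (stackWeb w v) 1

/-! ### Gluing webs side by side -/

/-- Two marked points of the glued disk are joined by an arc of the left web `w` or of the right
web `v`. The points of the glued disk are `Fin a` (left side), `Fin b` (the common side) and
`Fin c` (right side). -/
inductive Joined {a b c : ℕ} (w : BasisWeb a b) (v : BasisWeb b c) :
    Fin a ⊕ Fin b ⊕ Fin c → Fin a ⊕ Fin b ⊕ Fin c → Prop
  | left (x : Fin a ⊕ Fin b) :
      Joined w v (Sum.map id Sum.inl x) (Sum.map id Sum.inl (w.partner x))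
  | right (x : Fin b ⊕ Fin c) : Joined w v (Sum.inr x) (Sum.inr (v.partner x))

/-- Lying on the same curve of the glued picture. -/
def curveSetoid {a b c : ℕ} (w : BasisWeb a b) (v : BasisWeb b c) :
    Setoid (Fin a ⊕ Fin b ⊕ Fin c) :=
  Relation.EqvGen.setoid (Joined w v)

/-- The outer points of the glued disk among all its points. -/
def outer {a b c : ℕ} : Fin a ⊕ Fin c → Fin a ⊕ Fin b ⊕ Fin c :=
  Sum.map id Sum.inr

/-- The number of closed loops of the glued picture: the curves without outer points. -/
def loopCount {a b c : ℕ} (w : BasisWeb a b) (v : BasisWeb b c) : ℕ :=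
  Nat.card {C : Quotient (curveSetoid w v) //
    ∀ x : Fin a ⊕ Fin c, Quotient.mk (curveSetoid w v) (outer x) ≠ C}

/-- `u` consists of the arcs of the glued picture: two different outer points are joined in `u`
exactly if they lie on the same curve. -/
def IsGluing {a b c : ℕ} (w : BasisWeb a b) (v : BasisWeb b c) (u : BasisWeb a c) : Prop :=
  ∀ x y, u.partner x = y ↔ x ≠ y ∧ curveSetoid w v (outer x) (outer y)

open Classical in
/-- The web obtained from `w` (left) and `v` (right) by gluing along the common side and replacing
each closed loop by the factor `-[2]`. -/
def glueWeb {a b c : ℕ} (w : BasisWeb a b) (v : BasisWeb b c) : W a c :=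
  Finsupp.equivFunOnFinite.symm fun u =>
    if IsGluing w v u then (-qInt 2) ^ loopCount w v else 0

/-- Bilinear extension of `glueWeb` to web spaces; `glue x y` has `x` on the left and `y` on the
right. -/
def glue {a b c : ℕ} : W a b →ₗ[K] W b c →ₗ[K] W a c :=
  Finsupp.lift _ K _ fun w => Finsupp.lift _ K _ fun v => glueWeb w v

/-! ### Tangle diagrams and the Kauffman bracket -/

/-- Tangle diagrams on the disk with `m` left and `n` right marked points, cut into elementary
pieces by horizontal and vertical lines. -/
inductive Tangle : ℕ → ℕ → Type
  /-- parallel horizontal strands -/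
  | strands {m n : ℕ} (h : m = n) : Tangle m n
  /-- one arc with both ends on the right side -/
  | cup : Tangle 0 2
  /-- one arc with both ends on the left side -/
  | cap : Tangle 2 0
  /-- a crossing; the strand from upper left to lower right is over -/
  | overDown : Tangle 2 2
  /-- a crossing; the strand from lower left to upper right is over -/
  | overUp : Tangle 2 2
  /-- the first diagram to the left of the second -/
  | hcomp {a b c : ℕ} (D : Tangle a b) (E : Tangle b c) : Tangle a c
  /-- the first diagram above the second -/
  | vcomp {m n m' n' : ℕ} (D : Tangle m n) (E : Tangle m' n') : Tangle (m + m') (n + n')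

/-- Two horizontal strands. -/
def horizontalWeb : BasisWeb 2 2 := strandsWeb rfl

/-- Two turnbacks: an arc joining the left points and an arc joining the right points. -/
def turnWeb : BasisWeb 2 2 := stackWeb capWeb cupWeb

/-- The Kauffman bracket. The skein relation smooths a crossing into `q^{1/4}` times the smoothing
joining the regions swept out when the over strand is turned counterclockwise, plus `q^{-1/4}`
times the other one; a trivial loop is `-[2]` by the definition of `glue`. -/
def bracket : {m n : ℕ} → Tangle m n → W m n
  | _, _, .strands h => Finsupp.single (strandsWeb h) 1
  | _, _, .cup => Finsupp.single cupWeb 1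
  | _, _, .cap => Finsupp.single capWeb 1
  | _, _, .overDown =>
      t • Finsupp.single horizontalWeb 1 + t⁻¹ • Finsupp.single turnWeb 1
  | _, _, .overUp =>
      t • Finsupp.single turnWeb 1 + t⁻¹ • Finsupp.single horizontalWeb 1
  | _, _, .hcomp D E => glue (bracket D) (bracket E)
  | _, _, .vcomp D E => stack (bracket D) (bracket E)

/-- `n` parallel strands. -/
def strands (n : ℕ) : Tangle n n := .strands rfl

/-- `n` parallel (nested) arcs with all ends on the right side. -/
def cups : (n : ℕ) → Tangle 0 (n + n)
  | 0 => .strands rfl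
  | n + 1 => ((cups n).hcomp (((strands n).vcomp .cup).vcomp (strands n))).hcomp
      (.strands (by omega : n + 2 + n = (n + 1) + (n + 1)))

/-- `n` parallel (nested) arcs with all ends on the left side. -/
def caps : (n : ℕ) → Tangle (n + n) 0
  | 0 => .strands rfl
  | n + 1 => (Tangle.strands (by omega : (n + 1) + (n + 1) = n + 2 + n)).hcomp
      ((((strands n).vcomp .cap).vcomp (strands n)).hcomp (caps n))

/-- `k` parallel strands from upper left to lower right, crossing over one strand from lower left
to upper right. -/
def crossOne : (k : ℕ) → Tangle (k + 1) (1 + k)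
  | 0 => strands 1
  | k + 1 => ((strands k).vcomp .overDown).hcomp ((crossOne k).vcomp (strands 1))

/-- A crossing with decorated strands: `k` parallel strands from upper left to lower right, crossing
over `l` parallel strands from lower left to upper right. -/
def cross (k : ℕ) : (l : ℕ) → Tangle (k + l) (l + k)
  | 0 => .strands (by omega)
  | l + 1 => (((cross k l).vcomp (strands 1)).hcomp ((strands l).vcomp (crossOne k))).hcomp
      (.strands (by omega : l + (1 + k) = (l + 1) + k))

/-- `k` through strands at the top, `k` through strands at the bottom, and between them `n - k`
nested turnbacks on the left and `n - k` nested turnbacks on the right. -/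
def turnback (n : ℕ) (k : Fin (n + 1)) : Tangle (n + n) (n + n) :=
  ((Tangle.strands (by omega : n + n = k + ((n - k) + (n - k)) + k)).hcomp
    (((strands k).vcomp ((caps (n - k)).hcomp (cups (n - k)))).vcomp (strands k))).hcomp
    (.strands (by omega))

/-! ### Clasps -/

/-- The `A₁` clasp (Jones-Wenzl projector) on `n` strands; for `n = 0` it is the empty web. -/
def clasp : (n : ℕ) → W n n
  | 0 => bracket (strands 0)
  | 1 => bracket (strands 1)
  | n + 2 =>
      let p : W (n + 2) (n + 2) := stack (clasp (n + 1)) (bracket (strands 1))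
      p + (qInt (n + 1) / qInt (n + 2)) •
        glue (glue p (bracket ((strands n).vcomp (Tangle.cap.hcomp .cup)))) p

/-- The clasped web of a tangle diagram with `n + n` left and `n + n` right ends: each of the four
groups of `n` ends goes through a clasp. -/
def clasped (n : ℕ) (D : Tangle (n + n) (n + n)) : W (n + n) (n + n) :=
  glue (glue (stack (clasp n) (clasp n)) (bracket D)) (stack (clasp n) (clasp n))

/-- The closed loop colored by `n`, carrying one clasp. -/
def coloredLoop (n : ℕ) : W 0 0 :=
  glue (glue (bracket (cups n)) (stack (clasp n) (bracket (strands n)))) (bracket (caps n))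

/-- The empty disk, as an element of the web space without marked points. -/
def emptyDisk : W 0 0 := Finsupp.single (strandsWeb rfl) 1

end A1Web

end

noncomputable section

namespace A1Web

/-! ### Existence of gluings -/

/-! The crossing is computed in the Temperley--Lieb algebra on `2n` strands. There a single crossing
is `t + t⁻¹ e_i`, and the crossing of two bundles is a product of `n` descending words, one for each
under strand. The pair of clasps annihilates every generator except the middle one, `e_{n-1}`. The
under strands are resolved one at a time, from the last. With `j` turnbacks present and `l + 1`
under strands unresolved, expanding one more strand produces many terms. In most of them a turnback
slides through the unresolved crossings into the left clasp, or through the existing turnbacks into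
the right clasp. Only two terms survive, one with `j` turnbacks and one with `j + 1`
(`TLRel.crossing_step`). The resulting recursion of coefficients is the q-Pascal rule
(`crossCoeff_succ`), and after all `n` strands the term with `n - k` turnbacks is the `k`-th summand
(`TLRel.crossing`).

For the loop, closing the last strand of `P_{n+1}` gives `-[n+2]/[n+1]` times `P_n`
(`cupAt_jw_capAt`), and these factors telescope. This relation and the annihilation of generators by
a clasp come from one induction, `TLRel.jw_spec`.

The algebra itself has to be built from matchings. A curve of a glued picture is an orbit of two
involutions, so an outer point has exactly one opposite end (`existsUnique_endpoint`), and a mod 2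
linking number shows that the glued arcs do not cross (`gluedWeb`). Identities between pictures are
then checked by counting two-colorings of the marked points that are constant on arcs: the counts
determine both the web and its number of loops (`ind_scaled_injective`), so that associativity
becomes an exchange of finite sums. Finally `place_cross`, `place_clasp` and `bracket_turnback`
translate the pictures into words. -/

/-- In a dihedral orbit of a point fixed by one of the two generating involutions, exactly one
other point is fixed by one of them. -/
theorem existsUnique_endpoint {X : Type*} [Finite X] {α β : X → X}
    (hα : Function.Involutive α) (hβ : Function.Involutive β) {r : Setoid X}
    (hr : ∀ x y, r x y ↔ Relation.EqvGen (fun x y => y = α x ∨ y = β x) x y)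
    (hfix : ∀ x, ¬ (α x = x ∧ β x = x)) {x : X} (hx : β x = x) :
    ∃! y, y ≠ x ∧ r x y ∧ (α y = y ∨ β y = y) := by
  set a : Equiv.Perm X := hα.toPerm α with ha
  set b : Equiv.Perm X := hβ.toPerm β with hb
  set g : Equiv.Perm X := a * b with hg
  have haa : a * a = 1 := by ext z; simp [ha, hα z]
  have hbb : b * b = 1 := by ext z; simp [hb, hβ z]
  have hainv : a⁻¹ = a := inv_eq_of_mul_eq_one_left haa
  have hbinv : b⁻¹ = b := inv_eq_of_mul_eq_one_left hbb
  have hbx : b x = x := hx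
  -- Conjugation by `b` inverts `g`, and `b` fixes `x`. Hence the involutions act on the points `g ^
  -- k x` by reflecting exponents: `k ↦ -k` for `b` and `k ↦ 1 - k` for `a`.
  have hconj : ∀ k : ℤ, b * g ^ k = g ^ (-k) * b := by
    intro k
    have h1 : b * g * b⁻¹ = g⁻¹ := by
      rw [hg, mul_inv_rev, hainv, hbinv, ← mul_assoc b a b, mul_assoc _ b b, hbb, mul_one]
    have h2 : b * g ^ k * b⁻¹ = g ^ (-k) := by
      rw [← conj_zpow, h1, inv_zpow, zpow_neg]
    rw [← h2]; group
  have hbk : ∀ k : ℤ, b ((g ^ k) x) = (g ^ (-k)) x := by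
    intro k
    have := congrArg (fun p : Equiv.Perm X => p x) (hconj k)
    simpa [Equiv.Perm.mul_apply, hbx] using this
  have hak : ∀ k : ℤ, a ((g ^ k) x) = (g ^ (1 - k)) x := by
    intro k
    have : a = g * b := by rw [hg, mul_assoc, hbb, mul_one]
    rw [this, Equiv.Perm.mul_apply, hbk, ← Equiv.Perm.mul_apply, ← zpow_one_add]
    congr 2
  -- orbits
  have horb : ∀ y, r x y ↔ ∃ k : ℤ, (g ^ k) x = y := by
    intro y
    constructor
    · intro h
      rw [hr] at h
      have key : ∀ u v, Relation.EqvGen (fun x y => y = α x ∨ y = β x) u v →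
          ((∃ k : ℤ, (g ^ k) x = u) ↔ ∃ k : ℤ, (g ^ k) x = v) := by
        intro u v huv
        induction huv with
        | rel u v h =>
          rcases h with rfl | rfl
          · constructor
            · rintro ⟨k, rfl⟩; exact ⟨1 - k, (hak k).symm⟩
            · rintro ⟨k, hk⟩
              refine ⟨1 - k, ?_⟩
              rw [← hak, hk]; exact hα u
          · constructor
            · rintro ⟨k, rfl⟩; exact ⟨- k, (hbk k).symm⟩
            · rintro ⟨k, hk⟩
              refine ⟨- k, ?_⟩
              rw [← hbk, hk]; exact hβ u
        | refl => rfl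
        | symm _ _ _ ih => exact ih.symm
        | trans _ _ _ _ _ ih1 ih2 => exact ih1.trans ih2
      exact (key x y h).1 ⟨0, rfl⟩
    · have ra : ∀ z, r z (a z) := fun z => (hr _ _).2 (.rel _ _ (Or.inl rfl))
      have rb : ∀ z, r z (b z) := fun z => (hr _ _).2 (.rel _ _ (Or.inr rfl))
      have rg : ∀ z, r z (g z) := fun z => r.trans (rb z) (ra _)
      rintro ⟨k, rfl⟩
      induction k with
      | zero => exact r.refl _
      | succ i ih =>
        rw [add_comm, zpow_add, zpow_one]
        exact r.trans ih (rg _)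
      | pred i ih =>
        refine r.trans ih (r.symm ?_)
        have := rg ((g ^ (-(i : ℤ) - 1)) x)
        rwa [← Equiv.Perm.mul_apply, ← zpow_one_add, add_sub_cancel] at this
  -- period
  set s : ℕ := Function.minimalPeriod (g • ·) x with hs
  have hper : ∀ k : ℤ, (g ^ k) x = x ↔ (s : ℤ) ∣ k := fun k =>
    MulAction.zpow_smul_eq_iff_minimalPeriod_dvd (a := g) (b := x)
  have hper2 : ∀ k l : ℤ, (g ^ k) x = (g ^ l) x ↔ (s : ℤ) ∣ k - l := by
    intro k l
    rw [← hper, sub_eq_neg_add, zpow_add, zpow_neg, Equiv.Perm.mul_apply, Equiv.Perm.inv_eq_iff_eq]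
  have hspos : 0 < s := by
    have h1 : (s : ℤ) ∣ (orderOf g : ℤ) := by
      rw [← hper]; simp
    have h2 : 0 < orderOf g := orderOf_pos g
    rcases Nat.eq_zero_or_pos s with h | h
    · rw [h, Nat.cast_zero, zero_dvd_iff] at h1; omega
    · exact h
  have hend : ∀ k : ℤ, (α ((g ^ k) x) = (g ^ k) x ∨ β ((g ^ k) x) = (g ^ k) x) ↔
      ((s : ℤ) ∣ 2 * k - 1 ∨ (s : ℤ) ∣ 2 * k) := by
    intro k
    have h1 : α ((g ^ k) x) = (g ^ k) x ↔ (s : ℤ) ∣ 2 * k - 1 := by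
      change a ((g ^ k) x) = (g ^ k) x ↔ _
      rw [hak, hper2, ← dvd_neg]; ring_nf
    have h2 : β ((g ^ k) x) = (g ^ k) x ↔ (s : ℤ) ∣ 2 * k := by
      change b ((g ^ k) x) = (g ^ k) x ↔ _
      rw [hbk, hper2, ← dvd_neg]; ring_nf
    rw [h1, h2]
  have hodd : ∀ k : ℤ, (s : ℤ) ∣ 2 * k - 1 → s % 2 = 1 := by
    intro k hk
    by_contra h
    have : (2 : ℤ) ∣ s := by omega
    have := this.trans hk
    omega
  have hcop : s % 2 = 1 → ∀ k : ℤ, (s : ℤ) ∣ 2 * k → (s : ℤ) ∣ k := by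
    intro h k hk
    refine IsCoprime.dvd_of_dvd_mul_left ?_ hk
    rw [Int.isCoprime_iff_gcd_eq_one]
    have : Nat.Coprime s 2 := by
      rw [Nat.coprime_comm, Nat.coprime_two_left]; exact Nat.odd_iff.2 h
    simpa [Int.gcd] using this
  -- The other end lies halfway around the orbit: at `m` for period `2m`, at `m + 1` for period `2m
  -- + 1`. Period one is excluded because `x` would then be fixed by both involutions.
  obtain ⟨k, hk1, hk2⟩ : ∃ k : ℤ, ¬ (s : ℤ) ∣ k ∧ ((s : ℤ) ∣ 2 * k - 1 ∨ (s : ℤ) ∣ 2 * k) := by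
    rcases Nat.even_or_odd' s with ⟨m, hm | hm⟩
    · refine ⟨m, ?_, Or.inr ⟨1, by rw [hm]; push_cast; ring⟩⟩
      intro h
      have := Int.le_of_dvd (by omega) h
      omega
    · refine ⟨m + 1, ?_, Or.inl ⟨1, by rw [hm]; push_cast; ring⟩⟩
      intro h
      have := Int.le_of_dvd (by omega) h
      have hs1 : s = 1 := by omega
      have hfx : (g ^ (1 : ℤ)) x = x := (hper 1).2 (by rw [hs1]; simp)
      refine hfix x ⟨?_, hx⟩
      have h3 := hak 0
      simp only [sub_zero, hfx] at h3
      have h4 : a x = x := by simpa using h3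
      exact h4
  refine ⟨(g ^ k) x, ⟨fun h => hk1 ((hper k).1 h), (horb _).2 ⟨k, rfl⟩, (hend k).2 hk2⟩, ?_⟩
  rintro y ⟨hy1, hy2, hy3⟩
  obtain ⟨l, rfl⟩ := (horb y).1 hy2
  rw [hend] at hy3
  rw [Ne, hper] at hy1
  rw [hper2]
  rcases hk2 with hk2 | hk2 <;> rcases hy3 with hy3 | hy3
  · refine hcop (hodd _ hk2) _ ?_
    have := dvd_sub hy3 hk2
    rwa [show (2 * l - 1) - (2 * k - 1) = 2 * (l - k) by ring] at this
  · exact absurd (hcop (hodd _ hk2) _ hy3) hy1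
  · exact absurd (hcop (hodd _ hy3) _ hk2) hk1
  -- For even period both exponents are odd multiples of half the period, so they differ by a
  -- multiple of the period.
  · rcases Nat.even_or_odd' s with ⟨m, hm | hm⟩
    · obtain ⟨c, hc⟩ := hk2
      obtain ⟨d, hd⟩ := hy3
      have hkm : k = m * c := by
        have : (s : ℤ) = 2 * m := by exact_mod_cast hm
        rw [this] at hc; linarith
      have hlm : l = m * d := by
        have : (s : ℤ) = 2 * m := by exact_mod_cast hm
        rw [this] at hd; linarith
      have hs2 : (s : ℤ) = 2 * m := by exact_mod_cast hm
      have hc2 : c % 2 = 1 := by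
        by_contra h
        obtain ⟨e, he⟩ : (2 : ℤ) ∣ c := by omega
        exact hk1 ⟨e, by rw [hkm, hs2, he]; ring⟩
      have hd2 : d % 2 = 1 := by
        by_contra h
        obtain ⟨e, he⟩ : (2 : ℤ) ∣ d := by omega
        exact hy1 ⟨e, by rw [hlm, hs2, he]; ring⟩
      obtain ⟨e, he⟩ : (2 : ℤ) ∣ d - c := by omega
      refine ⟨e, ?_⟩
      rw [hlm, hkm, hs2, ← mul_sub, he]; ring
    · exact absurd (hcop (by omega) _ hk2) hk1

section Gluing

variable {a b c : ℕ} (w : BasisWeb a b) (v : BasisWeb b c)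

/-- The arcs of the left web, as an involution of all points of the glued disk. -/
def leftMove : Fin a ⊕ Fin b ⊕ Fin c → Fin a ⊕ Fin b ⊕ Fin c
  | Sum.inl i => Sum.map id Sum.inl (w.partner (Sum.inl i))
  | Sum.inr (Sum.inl j) => Sum.map id Sum.inl (w.partner (Sum.inr j))
  | Sum.inr (Sum.inr k) => Sum.inr (Sum.inr k)

/-- The arcs of the right web, as an involution of all points of the glued disk. -/
def rightMove : Fin a ⊕ Fin b ⊕ Fin c → Fin a ⊕ Fin b ⊕ Fin c
  | Sum.inl i => Sum.inl i
  | Sum.inr x => Sum.inr (v.partner x)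

theorem leftMove_map (x : Fin a ⊕ Fin b) :
    leftMove (c := c) w (Sum.map id Sum.inl x) = Sum.map id Sum.inl (w.partner x) := by
  rcases x with x | x <;> rfl

theorem leftMove_involutive : Function.Involutive (leftMove (c := c) w) := by
  rintro (i | j | k)
  · change leftMove w (Sum.map id Sum.inl _) = _
    rw [leftMove_map, w.partner_partner]; rfl
  · change leftMove w (Sum.map id Sum.inl _) = _
    rw [leftMove_map, w.partner_partner]; rfl
  · rfl

theorem rightMove_involutive : Function.Involutive (rightMove (a := a) v) := by
  rintro (i | x)
  · rfl
  · simp [rightMove, v.partner_partner]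

theorem leftMove_eq_self (x : Fin a ⊕ Fin b ⊕ Fin c) :
    leftMove w x = x ↔ ∃ k, x = Sum.inr (Sum.inr k) := by
  have inj : Function.Injective (Sum.map id Sum.inl : Fin a ⊕ Fin b → Fin a ⊕ Fin b ⊕ Fin c) :=
    Sum.map_injective.2 ⟨Function.injective_id, Sum.inl_injective⟩
  rcases x with i | j | k
  · have : ¬ leftMove (c := c) w (Sum.inl i) = Sum.inl i := fun h =>
      w.partner_ne (Sum.inl i) (inj h)
    simp [this]
  · have : ¬ leftMove (c := c) w (Sum.inr (Sum.inl j)) = Sum.inr (Sum.inl j) := fun h =>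
      w.partner_ne (Sum.inr j) (inj h)
    simp [this]
  · simp [leftMove]

theorem rightMove_eq_self (x : Fin a ⊕ Fin b ⊕ Fin c) :
    rightMove v x = x ↔ ∃ i, x = Sum.inl i := by
  rcases x with i | x
  · simp [rightMove]
  · simp [rightMove, v.partner_ne]

theorem curveSetoid_iff (x y : Fin a ⊕ Fin b ⊕ Fin c) :
    curveSetoid w v x y ↔
      Relation.EqvGen (fun x y => y = leftMove w x ∨ y = rightMove v x) x y := by
  change Relation.EqvGen _ x y ↔ _
  constructor
  · intro h
    induction h with
    | rel x y h =>
      refine .rel _ _ ?_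
      cases h with
      | left x => exact Or.inl (leftMove_map w x).symm
      | right x => exact Or.inr rfl
    | refl => exact .refl _
    | symm _ _ _ ih => exact .symm _ _ ih
    | trans _ _ _ _ _ ih1 ih2 => exact .trans _ _ _ ih1 ih2
  · intro h
    induction h with
    | rel x y h =>
      rcases h with rfl | rfl
      · rcases x with i | j | k
        · exact .rel _ _ (Joined.left (Sum.inl i))
        · exact .rel _ _ (Joined.left (Sum.inr j))
        · exact .refl _
      · rcases x with i | x
        · exact .refl _
        · exact .rel _ _ (Joined.right x)
    | refl => exact .refl _
    | symm _ _ _ ih => exact .symm _ _ ih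
    | trans _ _ _ _ _ ih1 ih2 => exact .trans _ _ _ ih1 ih2

theorem outer_injective : Function.Injective (outer : Fin a ⊕ Fin c → Fin a ⊕ Fin b ⊕ Fin c) :=
  Sum.map_injective.2 ⟨Function.injective_id, Sum.inr_injective⟩

/-- Each move fixes, by convention, the outer side its web does not reach. This turns ends of curves
into fixed points, the form needed for `existsUnique_endpoint`. -/
theorem move_eq_self_iff_outer (x : Fin a ⊕ Fin b ⊕ Fin c) :
    (leftMove w x = x ∨ rightMove v x = x) ↔ ∃ o, x = outer o := by
  rw [leftMove_eq_self, rightMove_eq_self]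
  constructor
  · rintro (⟨k, rfl⟩ | ⟨i, rfl⟩)
    · exact ⟨Sum.inr k, rfl⟩
    · exact ⟨Sum.inl i, rfl⟩
  · rintro ⟨i | k, rfl⟩
    · exact Or.inr ⟨i, rfl⟩
    · exact Or.inl ⟨k, rfl⟩

/-- Every outer point of the glued picture lies on the same curve as exactly one other. -/
theorem existsUnique_curve_end (x : Fin a ⊕ Fin c) :
    ∃! y, y ≠ x ∧ curveSetoid w v (outer x) (outer y) := by
  have hfix : ∀ z, ¬ (leftMove w z = z ∧ rightMove v z = z) := by
    intro z
    rw [leftMove_eq_self, rightMove_eq_self]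
    rintro ⟨⟨k, rfl⟩, ⟨i, h⟩⟩
    cases h
  have key : ∃! z, z ≠ outer x ∧ curveSetoid w v (outer x) z ∧
      (leftMove w z = z ∨ rightMove v z = z) := by
    rcases x with i | k
    · exact existsUnique_endpoint (leftMove_involutive w) (rightMove_involutive v)
        (curveSetoid_iff w v) hfix (x := outer (Sum.inl i)) rfl
    · have := existsUnique_endpoint (rightMove_involutive v) (leftMove_involutive w)
        (r := curveSetoid w v) (fun x y => by rw [curveSetoid_iff]; simp only [or_comm])
        (fun z h => hfix z h.symm) (x := outer (Sum.inr k)) rfl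
      simpa only [or_comm] using this
  obtain ⟨z, ⟨h1, h2, h3⟩, h4⟩ := key
  obtain ⟨y, rfl⟩ := (move_eq_self_iff_outer w v z).1 h3
  refine ⟨y, ⟨fun h => h1 (h ▸ rfl), h2⟩, ?_⟩
  rintro y' ⟨h1', h2'⟩
  exact outer_injective (h4 _ ⟨fun h => h1' (outer_injective h), h2',
    (move_eq_self_iff_outer w v _).2 ⟨y', rfl⟩⟩)

end Gluing

/-! ### Planarity of gluings -/

theorem bdryPos_injective {m n : ℕ} : Function.Injective (bdryPos : Fin m ⊕ Fin n → ℕ) := by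
  rintro (i | i) (j | j) h <;> simp [bdryPos] at h ⊢ <;> omega

/-- Two disjoint unions of arcs of a crossingless matching have an even linking number. -/
theorem sum_linking_eq_zero {m n : ℕ} (w : BasisWeb m n) (f g : Fin m ⊕ Fin n → ZMod 2)
    (hf : ∀ x, f (w.partner x) = f x) (hg : ∀ x, g (w.partner x) = g x)
    (hfg : ∀ x, f x * g x = 0) :
    ∑ x, ∑ y, f x * g y * (if bdryPos x < bdryPos y then 1 else 0 : ZMod 2) = 0 := by
  have hp : ∀ x, bdryPos (w.partner x) ≠ bdryPos x := fun x h =>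
    w.partner_ne x (bdryPos_injective h)
  rw [Finset.sum_comm]
  -- Terms cancel four at a time, for one arc weighted by `f` and one weighted by `g`: among the
  -- four pairs of their ends, arcs that do not interleave have an even number in increasing order.
  refine Finset.sum_involution (fun y _ => w.partner y) ?_ ?_ (by simp)
    (fun y _ => w.partner_partner y)
  · intro y _
    rw [hg, ← Finset.sum_add_distrib]
    refine Finset.sum_involution (fun x _ => w.partner x) ?_ ?_ (by simp)
      (fun x _ => w.partner_partner x)
    · intro x _
      rw [hf]
      by_cases h : f x * g y = 0
      · simp [h]
      · have hxy : bdryPos x ≠ bdryPos y := by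
          intro e; rw [bdryPos_injective e] at h; exact h (hfg y)
        have hxy' : bdryPos x ≠ bdryPos (w.partner y) := by
          intro e
          have := bdryPos_injective e
          rw [this, hf] at h; exact h (hfg y)
        have hx'y : bdryPos (w.partner x) ≠ bdryPos y := by
          intro e
          have := bdryPos_injective e
          rw [← this, hg] at h; exact h (hfg x)
        have hx'y' : bdryPos (w.partner x) ≠ bdryPos (w.partner y) := by
          intro e
          have := congrArg w.partner (bdryPos_injective e)
          rw [w.partner_partner, w.partner_partner] at this
          exact hxy (congrArg _ this)
        have n1 := w.noncrossing x y
        have n2 := w.noncrossing x (w.partner y)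
        have n3 := w.noncrossing (w.partner x) y
        have n4 := w.noncrossing (w.partner x) (w.partner y)
        have n5 := w.noncrossing y x
        have n6 := w.noncrossing y (w.partner x)
        have n7 := w.noncrossing (w.partner y) x
        have n8 := w.noncrossing (w.partner y) (w.partner x)
        simp only [w.partner_partner] at n1 n2 n3 n4 n5 n6 n7 n8
        have := hp x
        have := hp y
        rw [← mul_add, ← mul_add, ← mul_add]
        suffices h : ((if bdryPos x < bdryPos y then 1 else 0 : ZMod 2) +
            (if bdryPos x < bdryPos (w.partner y) then 1 else 0)) +
            ((if bdryPos (w.partner x) < bdryPos y then 1 else 0) +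
            (if bdryPos (w.partner x) < bdryPos (w.partner y) then 1 else 0)) = 0 by
          rw [h, mul_zero]
        split_ifs <;> first | rfl | (exfalso; omega)
    · intro x _ _ h
      exact w.partner_ne x h
  · intro y _ _ h
    exact w.partner_ne y h

theorem sum_arcs_eq_zero {m n : ℕ} (w : BasisWeb m n) (f : Fin m ⊕ Fin n → ZMod 2)
    (hf : ∀ x, f (w.partner x) = f x) : ∑ x, f x = 0 := by
  have two : ∀ z : ZMod 2, z + z = 0 := by decide
  refine Finset.sum_involution (fun x _ => w.partner x) ?_ ?_ (by simp)
    (fun x _ => w.partner_partner x)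
  · intro x _; rw [hf, two]
  · intro x _ _ h; exact w.partner_ne x h

end A1Web

end

noncomputable section

namespace A1Web

/-- The boundary is traversed down the left side and then up the right side: left points precede
right points, and the order on the right is reversed. -/
theorem sum_linking_split {m n : ℕ} (f g : Fin m ⊕ Fin n → ZMod 2) :
    ∑ x, ∑ y, f x * g y * (if bdryPos x < bdryPos y then 1 else 0 : ZMod 2) =
      (∑ i, ∑ j, f (Sum.inl i) * g (Sum.inl j) * (if i < j then 1 else 0)) +
      (∑ i, f (Sum.inl i)) * (∑ j, g (Sum.inr j)) +
      ∑ i, ∑ j, f (Sum.inr i) * g (Sum.inr j) * (if j < i then 1 else 0) := by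
  have h1 : ∀ i j : Fin m, (bdryPos (Sum.inl i : Fin m ⊕ Fin n) < bdryPos (Sum.inl j : Fin m ⊕ Fin n))
      ↔ i < j := fun i j => Iff.rfl
  have h2 : ∀ (i : Fin m) (j : Fin n), (bdryPos (Sum.inl i : Fin m ⊕ Fin n) <
      bdryPos (Sum.inr j : Fin m ⊕ Fin n)) ↔ True := by
    intro i j; simp only [bdryPos, iff_true]; omega
  have h3 : ∀ (i : Fin m) (j : Fin n), (bdryPos (Sum.inr j : Fin m ⊕ Fin n) <
      bdryPos (Sum.inl i : Fin m ⊕ Fin n)) ↔ False := by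
    intro i j; simp only [bdryPos, iff_false]; omega
  have h4 : ∀ i j : Fin n, (bdryPos (Sum.inr i : Fin m ⊕ Fin n) < bdryPos (Sum.inr j : Fin m ⊕ Fin n))
      ↔ j < i := by
    intro i j; simp only [bdryPos, Fin.lt_def]; omega
  simp only [Fintype.sum_sum_type, h1, h2, h3, h4, if_true, if_false, mul_one, mul_zero,
    Finset.sum_const_zero, Finset.sum_add_distrib, Finset.sum_mul_sum]
  ring

/-- The common side is traversed upwards as a side of `w` and downwards as a side of `v`; its two
contributions to the linking numbers complete each other to a product. -/
theorem sum_lt_add_sum_gt {n : ℕ} (f g : Fin n → ZMod 2) (h : ∀ i, f i * g i = 0) :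
    (∑ i, ∑ j, f i * g j * (if i < j then 1 else 0)) +
      (∑ i, ∑ j, f i * g j * (if j < i then 1 else 0)) = (∑ i, f i) * ∑ j, g j := by
  rw [Finset.sum_mul_sum, ← Finset.sum_add_distrib]
  refine Finset.sum_congr rfl fun i _ => ?_
  rw [← Finset.sum_add_distrib]
  refine Finset.sum_congr rfl fun j _ => ?_
  rcases lt_trichotomy i j with hij | hij | hij
  · simp [hij, hij.not_gt]
  · subst hij; simp [h]
  · simp [hij, hij.not_gt]

theorem sum_indicator_pair {ι : Type*} [Fintype ι] [DecidableEq ι] (F : ι → ι → ZMod 2)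
    (x x' y y' : ι) :
    ∑ p, ∑ q, ((if p = x then 1 else 0) + (if p = x' then 1 else 0)) *
      ((if q = y then 1 else 0) + (if q = y' then 1 else 0)) * F p q =
    F x y + F x y' + F x' y + F x' y' := by
  simp only [add_mul, mul_add, ite_mul, mul_ite, one_mul, zero_mul, mul_zero, mul_one,
    Finset.sum_add_distrib]
  simp [Finset.sum_add_distrib]
  ring

open Classical in
/-- The gluing of two basis webs, without its closed loops. -/
def gluedWeb {a b c : ℕ} (w : BasisWeb a b) (v : BasisWeb b c) : BasisWeb a c where
  partner x := (existsUnique_curve_end w v x).choose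
  partner_partner x := by
    have h1 := (existsUnique_curve_end w v x).choose_spec.1
    have h2 := (existsUnique_curve_end w v ((existsUnique_curve_end w v x).choose)).choose_spec.2 x
      ⟨h1.1.symm, (curveSetoid w v).symm h1.2⟩
    exact h2.symm
  partner_ne x := (existsUnique_curve_end w v x).choose_spec.1.1
  noncrossing x y := by
    -- Interleaving ends would give the curves through `x` and `y` the outer linking number 1.
    -- Cutting along the common side expresses the same number by the linking numbers inside `w` and
    -- `v`, which vanish, and by products of side totals.
    rintro ⟨hxy, hyx', hx'y'⟩
    obtain ⟨⟨hx1, hx2⟩, hx3⟩ := (existsUnique_curve_end w v x).choose_spec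
    obtain ⟨⟨hy1, hy2⟩, hy3⟩ := (existsUnique_curve_end w v y).choose_spec
    set x' := (existsUnique_curve_end w v x).choose
    set y' := (existsUnique_curve_end w v y).choose
    set r := curveSetoid w v
    have hnxy : ¬ r (outer x) (outer y) := by
      intro h
      have := hx3 y ⟨fun e => by rw [e] at hxy; exact lt_irrefl _ hxy, h⟩
      rw [this] at hyx'; exact lt_irrefl _ hyx'
    set f : Fin a ⊕ Fin b ⊕ Fin c → ZMod 2 := fun p => if r (outer x) p then 1 else 0 with hf
    set g : Fin a ⊕ Fin b ⊕ Fin c → ZMod 2 := fun p => if r (outer y) p then 1 else 0 with hg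
    have rel : ∀ p q, r p q → f p = f q ∧ g p = g q := by
      intro p q h
      have h1 : r (outer x) p ↔ r (outer x) q := ⟨fun e => r.trans e h, fun e => r.trans e (r.symm h)⟩
      have h2 : r (outer y) p ↔ r (outer y) q := ⟨fun e => r.trans e h, fun e => r.trans e (r.symm h)⟩
      simp only [hf, hg, h1, h2, and_self]
    have hfg : ∀ p, f p * g p = 0 := by
      intro p
      by_cases h1 : r (outer x) p <;> by_cases h2 : r (outer y) p
      · exact absurd (r.trans h1 (r.symm h2)) hnxy
      all_goals simp [hf, hg, h1, h2]
    have rl : ∀ p, r (Sum.map id Sum.inl p) (Sum.map id Sum.inl (w.partner p)) :=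
      fun p => .rel _ _ (Joined.left p)
    have rr : ∀ p, r (Sum.inr p) (Sum.inr (v.partner p)) := fun p => .rel _ _ (Joined.right p)
    have w0 := sum_linking_eq_zero w (fun p => f (Sum.map id Sum.inl p))
      (fun p => g (Sum.map id Sum.inl p)) (fun p => (rel _ _ (rl p)).1.symm)
      (fun p => (rel _ _ (rl p)).2.symm) (fun p => hfg _)
    have v0 := sum_linking_eq_zero v (fun p => f (Sum.inr p))
      (fun p => g (Sum.inr p)) (fun p => (rel _ _ (rr p)).1.symm)
      (fun p => (rel _ _ (rr p)).2.symm) (fun p => hfg _)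
    have wf := sum_arcs_eq_zero w (fun p => f (Sum.map id Sum.inl p))
      (fun p => (rel _ _ (rl p)).1.symm)
    have vg := sum_arcs_eq_zero v (fun p => g (Sum.inr p)) (fun p => (rel _ _ (rr p)).2.symm)
    have mm := sum_lt_add_sum_gt (fun j => f (Sum.inr (Sum.inl j))) (fun j => g (Sum.inr (Sum.inl j)))
      (fun j => hfg _)
    have oo := sum_linking_split (fun o : Fin a ⊕ Fin c => f (outer o)) (fun o => g (outer o))
    have fo : ∀ o, f (outer o) = (if o = x then 1 else 0) + (if o = x' then 1 else 0) := by
      intro o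
      by_cases h1 : o = x
      · subst h1
        simp [hf, hx1.symm]
      · by_cases h2 : o = x'
        · simp [hf, h2, hx2, hx1]
        · have : ¬ r (outer x) (outer o) := fun h => h2 (hx3 o ⟨h1, h⟩)
          simp [hf, h1, h2, this]
    have go : ∀ o, g (outer o) = (if o = y then 1 else 0) + (if o = y' then 1 else 0) := by
      intro o
      by_cases h1 : o = y
      · subst h1
        simp [hg, hy1.symm]
      · by_cases h2 : o = y'
        · simp [hg, h2, hy2, hy1]
        · have : ¬ r (outer y) (outer o) := fun h => h2 (hy3 o ⟨h1, h⟩)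
          simp [hg, h1, h2, this]
    have lhs : ∑ p, ∑ q, f (outer p) * g (outer q) *
        (if bdryPos p < bdryPos q then 1 else 0 : ZMod 2) = 1 := by
      simp only [fo, go]
      rw [sum_indicator_pair (fun p q => if bdryPos p < bdryPos q then 1 else 0)]
      rw [if_pos hxy, if_pos (hxy.trans (hyx'.trans hx'y')), if_neg hyx'.not_gt, if_pos hx'y']
      decide
    rw [sum_linking_split] at w0 v0
    rw [Fintype.sum_sum_type] at wf vg
    rw [lhs] at oo
    simp only [Sum.map_inl, Sum.map_inr, id, outer] at w0 v0 wf vg mm oo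
    have two : (2 : ZMod 2) = 0 := by decide
    refine one_ne_zero (α := ZMod 2) ?_
    generalize (∑ i, f (Sum.inl i)) = lf at *
    generalize (∑ i, f (Sum.inr (Sum.inl i))) = mf at *
    generalize (∑ i, g (Sum.inr (Sum.inl i))) = mg at *
    generalize (∑ i, g (Sum.inr (Sum.inr i))) = rg at *
    rw [oo]
    -- By `wf` and `vg` the left and middle totals of `f` agree mod 2, as do the middle and right
    -- totals of `g`; hence the products of totals cancel in pairs.
    linear_combination w0 + v0 + (- mg + rg) * wf - 2 * mf * vg + (-1) * mm + (mf * mg) * two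

theorem isGluing_gluedWeb {a b c : ℕ} (w : BasisWeb a b) (v : BasisWeb b c) :
    IsGluing w v (gluedWeb w v) := by
  intro x y
  have h := (existsUnique_curve_end w v x).choose_spec
  constructor
  · rintro rfl
    exact ⟨h.1.1.symm, h.1.2⟩
  · rintro ⟨h1, h2⟩
    exact (h.2 y ⟨h1.symm, h2⟩).symm

theorem glueWeb_eq_single {a b c : ℕ} (w : BasisWeb a b) (v : BasisWeb b c) :
    glueWeb w v = Finsupp.single (gluedWeb w v) ((-qInt 2) ^ loopCount w v) := by
  classical
  ext u
  have h : IsGluing w v u ↔ gluedWeb w v = u := by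
    constructor
    · intro h
      ext x : 2
      rw [eq_comm, h]
      exact (isGluing_gluedWeb w v x _).1 rfl
    · rintro rfl
      exact isGluing_gluedWeb w v
  simp only [glueWeb, Finsupp.equivFunOnFinite_symm_apply_apply, h, Finsupp.single_apply]

/-! ### Labelings of webs -/

/-- The labels of the marked points of a disk: the left points are labelled by `x`, the right
points by `y`. -/
def label {m n : ℕ} (x y : ℕ → Bool) : Fin m ⊕ Fin n → Bool :=
  Sum.elim (fun i => x i) (fun j => y j)

/-- The labels `x`, `y` are constant on the arcs of `w`. -/
def Sat {m n : ℕ} (w : BasisWeb m n) (x y : ℕ → Bool) : Prop :=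
  ∀ p, label x y (w.partner p) = label x y p

open Classical in
/-- The indicator of `Sat`. -/
def ind {m n : ℕ} (w : BasisWeb m n) (x y : ℕ → Bool) : ℕ := if Sat w x y then 1 else 0

/-- Extension of finitely many labels to all places. -/
def pad {n : ℕ} (y : Fin n → Bool) : ℕ → Bool := fun i => if h : i < n then y ⟨i, h⟩ else false

@[simp] theorem pad_coe {n : ℕ} (y : Fin n → Bool) (i : Fin n) : pad y i = y i := by
  simp [pad]

theorem pad_of_lt {n : ℕ} (y : Fin n → Bool) {i : ℕ} (h : i < n) : pad y i = y ⟨i, h⟩ := by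
  simp [pad, h]

theorem label_pad {m n : ℕ} (l : Fin m ⊕ Fin n → Bool) :
    label (pad fun i => l (Sum.inl i)) (pad fun j => l (Sum.inr j)) = l := by
  funext p
  rcases p with i | j <;> simp [label]

/-- The indicator of a single arc of `u` is constant on the arcs of `u`, hence on those of `v`;
therefore `v` must join the two ends of that arc. -/
theorem BasisWeb.eq_of_sat {m n : ℕ} {u v : BasisWeb m n} (h : ∀ x y, Sat u x y → Sat v x y) :
    u = v := by
  classical
  ext p : 2
  have h1 := h (pad fun i => decide (Sum.inl i = p ∨ Sum.inl i = u.partner p))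
    (pad fun j => decide (Sum.inr j = p ∨ Sum.inr j = u.partner p))
  simp only [Sat, label_pad (fun o => decide (o = p ∨ o = u.partner p))] at h1
  have h2 := h1 ?_ p
  · simp only [true_or, decide_true, decide_eq_true_eq, v.partner_ne, false_or] at h2
    exact h2.symm
  · intro o
    have e1 : u.partner o = p ↔ o = u.partner p :=
      ⟨fun h => by rw [← h, u.partner_partner], fun h => by rw [h, u.partner_partner]⟩
    have e2 : u.partner o = u.partner p ↔ o = p :=
      ⟨fun h => by rw [← u.partner_partner o, h, u.partner_partner], fun h => by rw [h]⟩
    rw [decide_eq_decide, e1, e2, or_comm]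

/-- Gluing `w` and `v` gives `k` closed loops and the web `u`, read off by counting labelings. -/
def Glues {a b c : ℕ} (w : BasisWeb a b) (v : BasisWeb b c) (k : ℕ) (u : BasisWeb a c) : Prop :=
  ∀ x z, ∑ y : Fin b → Bool, ind w x (pad y) * ind v (pad y) z = 2 ^ k * ind u x z

theorem sat_const {m n : ℕ} (w : BasisWeb m n) : Sat w (fun _ => false) (fun _ => false) := by
  intro p
  rcases p with i | j <;> rcases h : w.partner _ <;> simp [label]

/-- A constant labeling is admissible for every web, so it isolates the power of two; what remains
compares the admissible labelings. -/
theorem ind_scaled_injective {m n : ℕ} {u u' : BasisWeb m n} {k l : ℕ}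
    (h : ∀ x y, 2 ^ k * ind u x y = 2 ^ l * ind u' x y) : k = l ∧ u = u' := by
  have hkl : k = l := by
    have := h (fun _ => false) (fun _ => false)
    simp only [ind, sat_const, if_true, mul_one] at this
    exact Nat.pow_right_injective le_rfl this
  refine ⟨hkl, BasisWeb.eq_of_sat fun x y hs => ?_⟩
  have := h x y
  subst hkl
  by_contra hn
  simp [ind, hs, hn] at this

/-- Once the outer labels are compatible, the labels of the common side are forced on curves
reaching an outer point, and each closed loop carries one free Boolean. -/
theorem glues_gluedWeb {a b c : ℕ} (w : BasisWeb a b) (v : BasisWeb b c) :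
    Glues w v (loopCount w v) (gluedWeb w v) := by
  classical
  intro x z
  set r := curveSetoid w v
  set L : (ℕ → Bool) → Fin a ⊕ Fin b ⊕ Fin c → Bool :=
    fun y => Sum.elim (fun i => x i) (label y z) with hL
  have hLo : ∀ y o, L y (outer o) = label x z o := by
    rintro y (i | k) <;> rfl
  have hLl : ∀ y p, L y (Sum.map id Sum.inl p) = label x y p := by
    rintro y (i | k) <;> rfl
  have hS : ∀ y, Sat w x y ∧ Sat v y z ↔ ∀ p q, r p q → L y p = L y q := by
    intro y
    constructor
    · rintro ⟨h1, h2⟩ p q h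
      induction h with
      | rel p q h =>
        cases h with
        | left p => rw [hLl, hLl, h1]
        | right p => exact (h2 p).symm
      | refl => rfl
      | symm _ _ _ ih => exact ih.symm
      | trans _ _ _ _ _ ih1 ih2 => exact ih1.trans ih2
    · intro h
      refine ⟨fun p => ?_, fun p => ?_⟩
      · rw [← hLl, ← hLl]
        exact (h _ _ (.rel _ _ (Joined.left p))).symm
      · exact (h _ _ (.rel _ _ (Joined.right p))).symm
  have hsum : ∑ y : Fin b → Bool, ind w x (pad y) * ind v (pad y) z =
      Nat.card {y : Fin b → Bool // ∀ p q, r p q → L (pad y) p = L (pad y) q} := by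
    rw [Nat.card_eq_fintype_card, Fintype.card_subtype, Finset.card_filter]
    refine Finset.sum_congr rfl fun y _ => ?_
    simp only [ind, ← hS, ite_and, mul_ite, mul_one, mul_zero]
    split_ifs <;> rfl
  rw [hsum]
  by_cases hu : Sat (gluedWeb w v) x z
  · have hu' : ∀ o o', r (outer o) (outer o') → label x z o = label x z o' := by
      intro o o' h
      by_cases e : o = o'
      · rw [e]
      · rw [← (isGluing_gluedWeb w v o o').2 ⟨e, h⟩, hu]
    rw [ind, if_pos hu, mul_one]
    have hcard : 2 ^ loopCount w v = Nat.card ({C : Quotient r //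
        ∀ x : Fin a ⊕ Fin c, Quotient.mk r (outer x) ≠ C} → Bool) := by
      rw [Nat.card_fun, Nat.card_eq_fintype_card (α := Bool), Fintype.card_bool]; rfl
    rw [hcard]
    refine Nat.card_congr (Equiv.ofBijective
      (fun y C => Quotient.lift (L (pad y.1)) y.2 C.1) ⟨?_, ?_⟩)
    · rintro ⟨y, hy⟩ ⟨y', hy'⟩ h
      ext j
      by_cases hj : ∃ o : Fin a ⊕ Fin c, r (outer o) (Sum.inr (Sum.inl j))
      · obtain ⟨o, ho⟩ := hj
        have h1 := hy _ _ ho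
        have h2 := hy' _ _ ho
        rw [hLo] at h1 h2
        have := h1.symm.trans h2
        simpa [hL, label] using this
      · have := congrFun h ⟨Quotient.mk r (Sum.inr (Sum.inl j)), fun o ho =>
          hj ⟨o, Quotient.exact ho⟩⟩
        simpa [hL, label] using this
    · intro g
      -- A prescribed choice on the loops is extended to all points by giving every other curve the
      -- label of one of its outer points.
      set F : Fin a ⊕ Fin b ⊕ Fin c → Bool := fun p =>
        if h : ∃ o : Fin a ⊕ Fin c, Quotient.mk r (outer o) = Quotient.mk r p then
          label x z h.choose else g ⟨Quotient.mk r p, fun o ho => h ⟨o, ho⟩⟩ with hF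
      have hFr : ∀ p q, r p q → F p = F q := by
        intro p q h
        have : Quotient.mk r p = Quotient.mk r q := Quotient.sound h
        simp only [hF, this]
      have hFo : ∀ o, F (outer o) = label x z o := by
        intro o
        have h : ∃ o' : Fin a ⊕ Fin c, Quotient.mk r (outer o') = Quotient.mk r (outer o) := ⟨o, rfl⟩
        simp only [hF, dif_pos h]
        exact hu' _ _ (Quotient.exact h.choose_spec)
      have hFL : L (pad fun j => F (Sum.inr (Sum.inl j))) = F := by
        funext p
        rcases p with i | j | k
        · exact (hFo (Sum.inl i)).symm
        · simp [hL, label]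
        · exact (hFo (Sum.inr k)).symm
      refine ⟨⟨fun j => F (Sum.inr (Sum.inl j)), by rw [hFL]; exact hFr⟩, ?_⟩
      funext ⟨C, hC⟩
      induction C using Quotient.inductionOn with
      | h p =>
        simp only [Quotient.lift_mk, hFL]
        have : ¬ ∃ o : Fin a ⊕ Fin c, Quotient.mk r (outer o) = Quotient.mk r p := by
          rintro ⟨o, ho⟩; exact hC o ho
        simp only [hF, dif_neg this]
  · rw [ind, if_neg hu, mul_zero, Nat.card_eq_zero]
    left
    refine ⟨fun ⟨y, hy⟩ => hu fun o => ?_⟩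
    rw [← hLo (pad y), ← hLo (pad y)]
    exact (hy _ _ ((isGluing_gluedWeb w v o _).1 rfl).2).symm

theorem glueWeb_eq_of_glues {a b c : ℕ} {w : BasisWeb a b} {v : BasisWeb b c} {k : ℕ}
    {u : BasisWeb a c} (h : Glues w v k u) :
    glueWeb w v = (-qInt 2) ^ k • Finsupp.single u 1 := by
  obtain ⟨rfl, rfl⟩ := ind_scaled_injective fun x z => (h x z).symm.trans (glues_gluedWeb w v x z)
  rw [glueWeb_eq_single, Finsupp.smul_single, smul_eq_mul, mul_one]

end A1Web

end

noncomputable section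

namespace A1Web

/-! ### Labelings of elementary and stacked webs -/

theorem sat_congr {m n : ℕ} (w : BasisWeb m n) {x x' y y' : ℕ → Bool}
    (hx : ∀ i < m, x i = x' i) (hy : ∀ i < n, y i = y' i) : Sat w x y ↔ Sat w x' y' := by
  have : (label x y : Fin m ⊕ Fin n → Bool) = label x' y' := by
    funext p
    rcases p with i | j
    · exact hx i i.2
    · exact hy j j.2
  simp only [Sat, this]

theorem ind_congr {m n : ℕ} {m' n' : ℕ} {w : BasisWeb m n} {v : BasisWeb m' n'}
    {x x' y y' : ℕ → Bool} (h : Sat w x y ↔ Sat v x' y') : ind w x y = ind v x' y' := by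
  classical
  simp only [ind, h]

theorem BasisWeb.eq_of_sat_iff {m n : ℕ} {u v : BasisWeb m n} (h : ∀ x y, Sat u x y ↔ Sat v x y) :
    u = v := BasisWeb.eq_of_sat fun x y => (h x y).1

theorem sat_strandsWeb {m n : ℕ} (h : m = n) (x y : ℕ → Bool) :
    Sat (strandsWeb h) x y ↔ ∀ i < m, x i = y i := by
  subst h
  constructor
  · intro hs i hi
    exact (hs (Sum.inl ⟨i, hi⟩)).symm
  · rintro hs (i | j)
    · exact (hs i i.2).symm
    · exact hs j j.2

theorem sat_stackWeb {m n m' n' : ℕ} (w : BasisWeb m n) (v : BasisWeb m' n') (x y : ℕ → Bool) :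
    Sat (stackWeb w v) x y ↔
      Sat w x y ∧ Sat v (fun i => x (m + i)) (fun i => y (n + i)) := by
  have h1 : ∀ p, label x y (stackEquiv m n m' n' (Sum.inl p)) = label x y p := by
    rintro (i | j) <;> simp [label, stackEquiv]
  have h2 : ∀ p, label x y (stackEquiv m n m' n' (Sum.inr p)) =
      label (fun i => x (m + i)) (fun i => y (n + i)) p := by
    rintro (i | j) <;> simp [label, stackEquiv]
  constructor
  · intro h
    refine ⟨fun p => ?_, fun p => ?_⟩
    · have := h (stackEquiv m n m' n' (Sum.inl p))
      simpa [stackWeb, h1] using this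
    · have := h (stackEquiv m n m' n' (Sum.inr p))
      simpa [stackWeb, h2] using this
  · rintro ⟨hw, hv⟩ p
    obtain ⟨p | p, rfl⟩ := (stackEquiv m n m' n').surjective p
    · simpa [stackWeb, h1] using hw p
    · simpa [stackWeb, h2] using hv p

theorem sat_cupWeb (x y : ℕ → Bool) : Sat cupWeb x y ↔ y 0 = y 1 := by
  constructor
  · intro h
    exact h (Sum.inr 1)
  · rintro h (i | j)
    · exact i.elim0
    · fin_cases j
      · exact h.symm
      · exact h

theorem sat_capWeb (x y : ℕ → Bool) : Sat capWeb x y ↔ x 0 = x 1 := by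
  constructor
  · intro h
    exact h (Sum.inl 1)
  · rintro h (i | j)
    · fin_cases i
      · exact h.symm
      · exact h
    · exact j.elim0

/-- A labeling of the stacked common side is a pair of labelings, so the counting sum factors. -/
theorem glues_stackWeb {a b c a' b' c' : ℕ} {w : BasisWeb a b} {v : BasisWeb b c} {u : BasisWeb a c}
    {w' : BasisWeb a' b'} {v' : BasisWeb b' c'} {u' : BasisWeb a' c'} {k k' : ℕ}
    (h : Glues w v k u) (h' : Glues w' v' k' u') :
    Glues (stackWeb w w') (stackWeb v v') (k + k') (stackWeb u u') := by
  classical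
  intro x z
  have ind_stack : ∀ {m n m' n' : ℕ} (w : BasisWeb m n) (v : BasisWeb m' n') (x y : ℕ → Bool),
      ind (stackWeb w v) x y = ind w x y * ind v (fun i => x (m + i)) (fun i => y (n + i)) := by
    intro m n m' n' w v x y
    simp only [ind, sat_stackWeb, ite_and, mul_ite, mul_one, mul_zero]
    split_ifs <;> rfl
  have e1 : ∀ (y : Fin b → Bool) (y' : Fin b' → Bool), ∀ i < b,
      pad (Fin.append y y') i = pad y i := by
    intro y y' i hi
    rw [pad_of_lt _ (by omega : i < b + b'), pad_of_lt _ hi]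
    exact Fin.append_left y y' ⟨i, hi⟩
  have e2 : ∀ (y : Fin b → Bool) (y' : Fin b' → Bool), ∀ i < b',
      pad (Fin.append y y') (b + i) = pad y' i := by
    intro y y' i hi
    rw [pad_of_lt _ (by omega : b + i < b + b'), pad_of_lt _ hi]
    exact Fin.append_right y y' ⟨i, hi⟩
  rw [← (Fin.appendEquiv b b').sum_comp, Fintype.sum_prod_type, ind_stack u u', pow_add]
  have key : ∀ (y : Fin b → Bool) (y' : Fin b' → Bool),
      ind (stackWeb w w') x (pad (Fin.append y y')) * ind (stackWeb v v') (pad (Fin.append y y')) z =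
      (ind w x (pad y) * ind v (pad y) z) * (ind w' (fun i => x (a + i)) (pad y') *
        ind v' (pad y') (fun i => z (c + i))) := by
    intro y y'
    rw [ind_stack, ind_stack, ind_congr (sat_congr w (fun _ _ => rfl) (e1 y y')),
      ind_congr (sat_congr v (e1 y y') (fun _ _ => rfl)),
      ind_congr (sat_congr w' (fun _ _ => rfl) (e2 y y')),
      ind_congr (sat_congr v' (e2 y y') (fun _ _ => rfl))]
    ring
  calc _ = ∑ y : Fin b → Bool, ∑ y' : Fin b' → Bool, (ind w x (pad y) * ind v (pad y) z) *
        (ind w' (fun i => x (a + i)) (pad y') * ind v' (pad y') (fun i => z (c + i))) :=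
      Finset.sum_congr rfl fun y _ => Finset.sum_congr rfl fun y' _ => key y y'
    _ = _ := by
      rw [← Finset.sum_mul_sum, h x z, h' _ _]; ring

theorem glues_strandsWeb_left {b c : ℕ} (v : BasisWeb b c) : Glues (strandsWeb rfl) v 0 v := by
  classical
  intro x z
  rw [Finset.sum_eq_single (fun i : Fin b => x i)]
  · have h : ∀ i < b, pad (fun i : Fin b => x i) i = x i := fun i hi => pad_of_lt _ hi
    rw [ind, if_pos ((sat_strandsWeb rfl _ _).2 fun i hi => (h i hi).symm),
      ind_congr (sat_congr v h fun _ _ => rfl), pow_zero]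
  · intro y _ hy
    rw [ind, if_neg, zero_mul]
    rw [sat_strandsWeb]
    intro h
    refine hy (funext fun i => ?_)
    have := h i i.2
    rw [pad_coe] at this
    exact this.symm
  · simp

theorem glues_strandsWeb_right {a b : ℕ} (w : BasisWeb a b) : Glues w (strandsWeb rfl) 0 w := by
  classical
  intro x z
  rw [Finset.sum_eq_single (fun i : Fin b => z i)]
  · have h : ∀ i < b, pad (fun i : Fin b => z i) i = z i := fun i hi => pad_of_lt _ hi
    rw [mul_comm, ind, if_pos ((sat_strandsWeb rfl _ _).2 h),
      ind_congr (sat_congr w (fun _ _ => rfl) h), pow_zero]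
  · intro y _ hy
    rw [mul_comm, ind, if_neg, zero_mul]
    rw [sat_strandsWeb]
    intro h
    refine hy (funext fun i => ?_)
    have := h i i.2
    rw [pad_coe] at this
    exact this
  · simp

/-! ### Placing a web between parallel strands -/

/-- `w` with `a` strands above and `b` strands below. -/
def placeWeb {m n : ℕ} (a b : ℕ) {N N' : ℕ} (hm : a + m + b = N) (hn : a + n + b = N')
    (w : BasisWeb m n) : BasisWeb N N' :=
  hm ▸ hn ▸ stackWeb (stackWeb (strandsWeb (rfl : a = a)) w) (strandsWeb (rfl : b = b))

theorem sat_placeWeb {m n : ℕ} (a b : ℕ) {N N' : ℕ} (hm : a + m + b = N) (hn : a + n + b = N')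
    (w : BasisWeb m n) (x y : ℕ → Bool) :
    Sat (placeWeb a b hm hn w) x y ↔ (∀ i < a, x i = y i) ∧
      Sat w (fun i => x (a + i)) (fun i => y (a + i)) ∧
      ∀ i < b, x (a + m + i) = y (a + n + i) := by
  subst hm hn
  simp only [placeWeb, sat_stackWeb, sat_strandsWeb, and_assoc]

/-- Linear extension of `placeWeb`. -/
def place {m n : ℕ} (a b : ℕ) {N N' : ℕ} (hm : a + m + b = N) (hn : a + n + b = N') :
    W m n →ₗ[K] W N N' := Finsupp.lmapDomain K K (placeWeb a b hm hn)

theorem place_single {m n : ℕ} (a b : ℕ) {N N' : ℕ} (hm : a + m + b = N) (hn : a + n + b = N')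
    (w : BasisWeb m n) (r : K) :
    place a b hm hn (Finsupp.single w r) = Finsupp.single (placeWeb a b hm hn w) r := by
  simp [place]

theorem glue_single {a b c : ℕ} (w : BasisWeb a b) (v : BasisWeb b c) (r s : K) :
    glue (Finsupp.single w r) (Finsupp.single v s) = (r * s) • glueWeb w v := by
  simp [glue, smul_smul]

theorem stack_single {m n m' n' : ℕ} (w : BasisWeb m n) (v : BasisWeb m' n') (r s : K) :
    stack (Finsupp.single w r) (Finsupp.single v s) = Finsupp.single (stackWeb w v) (r * s) := by
  simp [stack]

theorem glue_single_of_glues {a b c : ℕ} {w : BasisWeb a b} {v : BasisWeb b c} {k : ℕ}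
    {u : BasisWeb a c} (h : Glues w v k u) (r s : K) :
    glue (Finsupp.single w r) (Finsupp.single v s) =
      Finsupp.single u (r * s * (-qInt 2) ^ k) := by
  rw [glue_single, glueWeb_eq_of_glues h, smul_smul, Finsupp.smul_single, smul_eq_mul, mul_one]

/-- Both bracketings count labelings of the two inner sides, summed in different orders. Equality of
counts yields equality of the webs and of the total numbers of loops. -/
theorem glue_assoc {a b c d : ℕ} (x : W a b) (y : W b c) (z : W c d) :
    glue (glue x y) z = glue x (glue y z) := by
  induction x using Finsupp.induction_linear with
  | zero => simp
  | add x x' hx hx' => simp [hx, hx']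
  | single w r =>
  induction y using Finsupp.induction_linear with
  | zero => simp
  | add x x' hx hx' => simp [hx, hx']
  | single v s =>
  induction z using Finsupp.induction_linear with
  | zero => simp
  | add x x' hx hx' => simp [hx, hx']
  | single u p =>
  have h1 := glues_gluedWeb w v
  have h2 := glues_gluedWeb (gluedWeb w v) u
  have h3 := glues_gluedWeb v u
  have h4 := glues_gluedWeb w (gluedWeb v u)
  obtain ⟨hk, hu⟩ := ind_scaled_injective (u := gluedWeb (gluedWeb w v) u)
    (u' := gluedWeb w (gluedWeb v u)) (k := loopCount w v + loopCount (gluedWeb w v) u)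
    (l := loopCount v u + loopCount w (gluedWeb v u)) (by
      intro x z
      have h1' : ∀ y, 2 ^ loopCount w v * ind (gluedWeb w v) x y = _ := fun y => (h1 x y).symm
      have h3' : ∀ y, 2 ^ loopCount v u * ind (gluedWeb v u) y z = _ := fun y => (h3 y z).symm
      rw [pow_add, pow_add, mul_assoc, ← h2, mul_assoc, ← h4, Finset.mul_sum, Finset.mul_sum]
      simp only [← mul_assoc, h1']
      simp only [mul_comm (2 ^ _) (ind w x _), mul_assoc, h3']
      simp only [Finset.sum_mul, Finset.mul_sum]
      rw [Finset.sum_comm]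
      simp only [mul_assoc])
  rw [glue_single_of_glues h1, glue_single_of_glues h2, glue_single_of_glues h3,
    glue_single_of_glues h4, hu]
  congr 1
  have := congrArg ((-qInt 2) ^ ·) hk
  simp only [pow_add] at this
  linear_combination (r * s * p) * this

theorem place_glue {m n l : ℕ} (a b : ℕ) {N N' N'' : ℕ} (hm : a + m + b = N) (hn : a + n + b = N')
    (hl : a + l + b = N'') (x : W m n) (y : W n l) :
    place a b hm hl (glue x y) = glue (place a b hm hn x) (place a b hn hl y) := by
  induction x using Finsupp.induction_linear with
  | zero => simp
  | add x x' hx hx' => simp [hx, hx']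
  | single w r =>
  induction y using Finsupp.induction_linear with
  | zero => simp
  | add x x' hx hx' => simp [hx, hx']
  | single v s =>
  have h := glues_gluedWeb w v
  have h' : Glues (placeWeb a b hm hn w) (placeWeb a b hn hl v) (loopCount w v)
      (placeWeb a b hm hl (gluedWeb w v)) := by
    subst hm hn hl
    have := glues_stackWeb (glues_stackWeb (glues_strandsWeb_left (strandsWeb (rfl : a = a))) h)
      (glues_strandsWeb_left (strandsWeb (rfl : b = b)))
    rwa [zero_add, add_zero] at this
  rw [place_single, place_single, glue_single_of_glues h, glue_single_of_glues h', place_single]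

/-- The interchange law with the upper web glued on the left: while it acts, the lower web is still
represented by its `m'` left strands. In `place_stack'` the lower web comes first. -/
theorem place_stack {m n m' n' : ℕ} (a b : ℕ) {N N' N'' : ℕ} {b₁ a₂ : ℕ}
    (h : a + (m + m') + b = N) (h' : a + (n + n') + b = N'')
    (hm : a + m + b₁ = N) (hn : a + n + b₁ = N') (hm' : a₂ + m' + b = N') (hn' : a₂ + n' + b = N'')
    (x : W m n) (y : W m' n') :
    place a b h h' (stack x y) = glue (place a b₁ hm hn x) (place a₂ b hm' hn' y) := by
  obtain rfl : a₂ = a + n := by omega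
  obtain rfl : b₁ = m' + b := by omega
  have hN : a + (n + m') + b = N' := by omega
  induction x using Finsupp.induction_linear with
  | zero => simp
  | add x x' hx hx' => simp [hx, hx']
  | single w r =>
  induction y using Finsupp.induction_linear with
  | zero => simp
  | add x x' hx hx' => simp [hx, hx']
  | single v s =>
  have e1 : placeWeb a (m' + b) hm hn w =
      placeWeb a b h hN (stackWeb w (strandsWeb (rfl : m' = m'))) := by
    refine BasisWeb.eq_of_sat_iff fun x y => ?_
    simp only [sat_placeWeb, sat_stackWeb, sat_strandsWeb, and_assoc]
    refine and_congr_right fun _ => and_congr_right fun _ => ?_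
    constructor
    · intro hh
      refine ⟨fun i hi => ?_, fun i hi => ?_⟩
      · simpa [add_assoc] using hh i (by omega)
      · simpa [add_assoc] using hh (m' + i) (by omega)
    · rintro ⟨h1, h2⟩ i hi
      by_cases him : i < m'
      · simpa [add_assoc] using h1 i him
      · obtain ⟨j, rfl⟩ := Nat.exists_eq_add_of_le (not_lt.1 him)
        simpa [add_assoc] using h2 j (by omega)
  have e2 : placeWeb (a + n) b hm' hn' v =
      placeWeb a b hN h' (stackWeb (strandsWeb (rfl : n = n)) v) := by
    refine BasisWeb.eq_of_sat_iff fun x y => ?_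
    simp only [sat_placeWeb, sat_stackWeb, sat_strandsWeb, add_assoc]
    constructor
    · rintro ⟨h1, h2, h3⟩
      exact ⟨fun i hi => h1 i (by omega), ⟨fun i hi => h1 _ (by omega), h2⟩, h3⟩
    · rintro ⟨h1, ⟨h2, h3⟩, h4⟩
      refine ⟨fun i hi => ?_, h3, h4⟩
      by_cases hia : i < a
      · exact h1 i hia
      · obtain ⟨j, rfl⟩ := Nat.exists_eq_add_of_le (not_lt.1 hia)
        exact h2 j (by omega)
  rw [place_single, place_single, e1, e2, ← place_single, ← place_single, ← place_glue,
    glue_single_of_glues (glues_stackWeb (glues_strandsWeb_right w) (glues_strandsWeb_left v)),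
    stack_single]
  simp

theorem place_stack' {m n m' n' : ℕ} (a b : ℕ) {N N' N'' : ℕ} {b₁ a₂ : ℕ}
    (h : a + (m + m') + b = N) (h' : a + (n + n') + b = N'')
    (hm : a + m + b₁ = N') (hn : a + n + b₁ = N'') (hm' : a₂ + m' + b = N) (hn' : a₂ + n' + b = N')
    (x : W m n) (y : W m' n') :
    place a b h h' (stack x y) = glue (place a₂ b hm' hn' y) (place a b₁ hm hn x) := by
  obtain rfl : a₂ = a + m := by omega
  obtain rfl : b₁ = n' + b := by omega
  have hN : a + (m + n') + b = N' := by omega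
  induction x using Finsupp.induction_linear with
  | zero => simp
  | add x x' hx hx' => simp [hx, hx']
  | single w r =>
  induction y using Finsupp.induction_linear with
  | zero => simp
  | add x x' hx hx' => simp [hx, hx']
  | single v s =>
  have e1 : placeWeb a (n' + b) hm hn w =
      placeWeb a b hN h' (stackWeb w (strandsWeb (rfl : n' = n'))) := by
    refine BasisWeb.eq_of_sat_iff fun x y => ?_
    simp only [sat_placeWeb, sat_stackWeb, sat_strandsWeb, and_assoc]
    refine and_congr_right fun _ => and_congr_right fun _ => ?_
    constructor
    · intro hh
      refine ⟨fun i hi => ?_, fun i hi => ?_⟩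
      · simpa [add_assoc] using hh i (by omega)
      · simpa [add_assoc] using hh (n' + i) (by omega)
    · rintro ⟨h1, h2⟩ i hi
      by_cases him : i < n'
      · simpa [add_assoc] using h1 i him
      · obtain ⟨j, rfl⟩ := Nat.exists_eq_add_of_le (not_lt.1 him)
        simpa [add_assoc] using h2 j (by omega)
  have e2 : placeWeb (a + m) b hm' hn' v =
      placeWeb a b h hN (stackWeb (strandsWeb (rfl : m = m)) v) := by
    refine BasisWeb.eq_of_sat_iff fun x y => ?_
    simp only [sat_placeWeb, sat_stackWeb, sat_strandsWeb, add_assoc]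
    constructor
    · rintro ⟨h1, h2, h3⟩
      exact ⟨fun i hi => h1 i (by omega), ⟨fun i hi => h1 _ (by omega), h2⟩, h3⟩
    · rintro ⟨h1, ⟨h2, h3⟩, h4⟩
      refine ⟨fun i hi => ?_, h3, h4⟩
      by_cases hia : i < a
      · exact h1 i hia
      · obtain ⟨j, rfl⟩ := Nat.exists_eq_add_of_le (not_lt.1 hia)
        exact h2 j (by omega)
  rw [place_single, place_single, e1, e2, ← place_single, ← place_single, ← place_glue,
    glue_single_of_glues (glues_stackWeb (glues_strandsWeb_left w) (glues_strandsWeb_right v)),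
    stack_single]
  simp [mul_comm]

theorem place_place {m n : ℕ} (a b a' b' : ℕ) {N N' M M' : ℕ} (hm : a + m + b = N)
    (hn : a + n + b = N') (hM : a' + N + b' = M) (hM' : a' + N' + b' = M') (x : W m n) :
    place a' b' hM hM' (place a b hm hn x) =
      place (a' + a) (b + b') (by omega) (by omega) x := by
  induction x using Finsupp.induction_linear with
  | zero => simp
  | add x x' hx hx' => simp [hx, hx']
  | single w r =>
  rw [place_single, place_single, place_single]
  congr 1
  refine BasisWeb.eq_of_sat_iff fun x y => ?_
  subst hm hn
  simp only [sat_placeWeb, add_assoc]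
  constructor
  · rintro ⟨h1, ⟨h2, h3, h4⟩, h5⟩
    refine ⟨fun i hi => ?_, h3, fun i hi => ?_⟩
    · by_cases hia : i < a'
      · exact h1 i hia
      · obtain ⟨j, rfl⟩ := Nat.exists_eq_add_of_le (not_lt.1 hia)
        exact h2 j (by omega)
    · by_cases hib : i < b
      · exact h4 i hib
      · obtain ⟨j, rfl⟩ := Nat.exists_eq_add_of_le (not_lt.1 hib)
        exact h5 j (by omega)
  · rintro ⟨h1, h2, h3⟩
    exact ⟨fun i hi => h1 i (by omega), ⟨fun i hi => h1 _ (by omega), h2,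
      fun i hi => h3 i (by omega)⟩, fun i hi => h3 (b + i) (by omega)⟩

theorem place_strandsWeb {m n : ℕ} (a b : ℕ) {N N' : ℕ} (hm : a + m + b = N) (hn : a + n + b = N')
    (h : m = n) : place a b hm hn (Finsupp.single (strandsWeb h) 1) =
      Finsupp.single (strandsWeb (by omega)) 1 := by
  subst h hm hn
  rw [place_single]
  congr 1
  refine BasisWeb.eq_of_sat_iff fun x y => ?_
  simp only [sat_placeWeb, sat_strandsWeb]
  constructor
  · rintro ⟨h1, h2, h3⟩ i hi
    by_cases hia : i < a
    · exact h1 i hia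
    · obtain ⟨j, rfl⟩ := Nat.exists_eq_add_of_le (not_lt.1 hia)
      by_cases hj : j < m
      · exact h2 j hj
      · obtain ⟨l, rfl⟩ := Nat.exists_eq_add_of_le (not_lt.1 hj)
        simpa [add_assoc] using h3 l (by omega)
  · intro h
    exact ⟨fun i hi => h i (by omega), fun i hi => h _ (by omega), fun i hi => h _ (by omega)⟩

theorem place_zero_zero {m n : ℕ} (hm : 0 + m + 0 = m) (hn : 0 + n + 0 = n) (x : W m n) :
    place 0 0 hm hn x = x := by
  induction x using Finsupp.induction_linear with
  | zero => simp
  | add x x' hx hx' => simp [hx, hx']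
  | single w r =>
  rw [place_single]
  congr 1
  refine BasisWeb.eq_of_sat_iff fun x y => ?_
  simp [sat_placeWeb]

/-- Here `place 0 0` serves as the transport between disks whose numbers of points are equal but
written differently. -/
theorem glue_strandsWeb_left {a b c : ℕ} (h : a = b) (x : W b c) :
    glue (Finsupp.single (strandsWeb h) 1) x = place 0 0 (by omega) (by omega) x := by
  subst h
  rw [place_zero_zero]
  induction x using Finsupp.induction_linear with
  | zero => simp
  | add x x' hx hx' => rw [map_add, hx, hx']
  | single w r => rw [glue_single_of_glues (glues_strandsWeb_left w)]; simp

theorem glue_strandsWeb_right {a b c : ℕ} (h : b = c) (x : W a b) :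
    glue x (Finsupp.single (strandsWeb h) 1) = place 0 0 (by omega) (by omega) x := by
  subst h
  rw [place_zero_zero]
  induction x using Finsupp.induction_linear with
  | zero => simp
  | add x x' hx hx' => rw [map_add, LinearMap.add_apply, hx, hx']
  | single w r => rw [glue_single_of_glues (glues_strandsWeb_right w)]; simp

/-! ### Loop removal and the two zigzag relations -/

theorem glue_cup_cap : glue (bracket .cup) (bracket .cap) = (-qInt 2) • emptyDisk := by
  have h : Glues cupWeb capWeb 1 (strandsWeb (rfl : 0 = 0)) := by
    intro x z
    simp only [ind, sat_cupWeb, sat_capWeb, sat_strandsWeb]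
    simp [pad]
    decide
  simp only [bracket, emptyDisk]
  rw [glue_single_of_glues h]
  simp

theorem glue_place_cup_place_cap :
    glue (place 0 1 (by omega) (by omega) (bracket .cup) : W 1 3)
      (place 1 0 (by omega) (by omega) (bracket .cap) : W 3 1) =
      Finsupp.single (strandsWeb rfl) 1 := by
  have h : Glues (placeWeb 0 1 (by omega) (by omega) cupWeb : BasisWeb 1 3)
      (placeWeb 1 0 (by omega) (by omega) capWeb : BasisWeb 3 1) 0 (strandsWeb rfl) := by
    intro x z
    simp only [ind, sat_cupWeb, sat_capWeb, sat_strandsWeb, sat_placeWeb]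
    simp [pad]
    generalize x 0 = p
    generalize z 0 = r
    revert p r
    decide
  simp only [bracket, place_single]
  rw [glue_single_of_glues h]
  simp

theorem glue_place_cup_place_cap' :
    glue (place 1 0 (by omega) (by omega) (bracket .cup) : W 1 3)
      (place 0 1 (by omega) (by omega) (bracket .cap) : W 3 1) =
      Finsupp.single (strandsWeb rfl) 1 := by
  have h : Glues (placeWeb 1 0 (by omega) (by omega) cupWeb : BasisWeb 1 3)
      (placeWeb 0 1 (by omega) (by omega) capWeb : BasisWeb 3 1) 0 (strandsWeb rfl) := by
    intro x z
    simp only [ind, sat_cupWeb, sat_capWeb, sat_strandsWeb, sat_placeWeb]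
    simp [pad]
    generalize x 0 = p
    generalize z 0 = r
    revert p r
    decide
  simp only [bracket, place_single]
  rw [glue_single_of_glues h]
  simp

end A1Web

end

noncomputable section

namespace A1Web

/-! ### Quantum integers -/

theorem t_ne_zero : t ≠ 0 := RatFunc.X_ne_zero

theorem t_pow_ne_one {n : ℕ} (hn : n ≠ 0) : t ^ n ≠ 1 := by
  intro h
  have h1 : algebraMap (Polynomial ℚ) (RatFunc ℚ) (Polynomial.X ^ n) =
      algebraMap (Polynomial ℚ) (RatFunc ℚ) 1 := by
    rw [map_pow, RatFunc.algebraMap_X, map_one]; exact h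
  have h2 := congrArg Polynomial.natDegree (RatFunc.algebraMap_injective ℚ h1)
  rw [Polynomial.natDegree_X_pow, Polynomial.natDegree_one] at h2
  exact hn h2

theorem qBrace_ne_zero {k : ℕ} (hk : k ≠ 0) : qBrace k ≠ 0 := by
  intro h
  have h1 : t ^ (2 * (k : ℤ)) = t ^ (-(2 * (k : ℤ))) := sub_eq_zero.1 h
  have h2 : t ^ (4 * k) = 1 := by
    have : t ^ (2 * (k : ℤ)) * t ^ (2 * (k : ℤ)) = 1 := by
      nth_rewrite 1 [h1]
      rw [← zpow_add₀ t_ne_zero]; simp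
    rw [← zpow_natCast, ← this, ← zpow_add₀ t_ne_zero]
    congr 1; push_cast; ring
  exact t_pow_ne_one (by omega) h2

theorem qInt_ne_zero {k : ℕ} (hk : k ≠ 0) : qInt k ≠ 0 :=
  div_ne_zero (qBrace_ne_zero hk) (by exact_mod_cast qBrace_ne_zero one_ne_zero)

theorem qInt_one : qInt 1 = 1 := div_self (by exact_mod_cast qBrace_ne_zero one_ne_zero)

/-- This three-term recursion is what advances the partial trace scalar in `TLRel.jw_spec`. -/
theorem qInt_add_two (k : ℤ) : qInt (k + 2) = qInt 2 * qInt (k + 1) - qInt k := by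
  have h1 : qBrace 1 ≠ 0 := by exact_mod_cast qBrace_ne_zero one_ne_zero
  have ht := t_ne_zero
  have h : qBrace (k + 2) * qBrace 1 = qBrace 2 * qBrace (k + 1) - qBrace k * qBrace 1 := by
    simp only [qBrace, mul_sub, sub_mul, ← zpow_add₀ ht]
    ring_nf
  simp only [qInt]
  field_simp
  linear_combination h

theorem qInt_two : qInt 2 = t ^ 2 + (t⁻¹) ^ 2 := by
  have h1 : qBrace 1 ≠ 0 := by exact_mod_cast qBrace_ne_zero one_ne_zero
  rw [qInt, div_eq_iff h1]
  have ht := t_ne_zero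
  simp only [qBrace]
  norm_num [zpow_neg]
  field_simp
  ring

section Words

variable {A : Type*} [Ring A]

/-! ### Words in the generators -/

/-- `desc e p k = e (p + k - 1) * ⋯ * e (p + 1) * e p`. -/
def desc (e : ℕ → A) (p : ℕ) : ℕ → A
  | 0 => 1
  | k + 1 => e (p + k) * desc e p k

/-- `asc e p k = e p * e (p + 1) * ⋯ * e (p + k - 1)`. -/
def asc (e : ℕ → A) (p : ℕ) : ℕ → A
  | 0 => 1
  | k + 1 => asc e p k * e (p + k)

/-- The product of the `j` words `desc e p a`, `desc e (p + 1) a`, ... -/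
def rows (e : ℕ → A) (p a : ℕ) : ℕ → A
  | 0 => 1
  | j + 1 => rows e p a j * desc e (p + j) a

theorem desc_add (e : ℕ → A) (p k l : ℕ) : desc e p (k + l) = desc e (p + k) l * desc e p k := by
  induction l with
  | zero => simp [desc]
  | succ l ih => rw [← add_assoc, desc, ih, desc, mul_assoc, add_assoc]

theorem desc_succ' (e : ℕ → A) (p k : ℕ) : desc e p (k + 1) = desc e (p + 1) k * e p := by
  rw [add_comm, desc_add]
  simp [desc]

theorem commute_desc {e : ℕ → A} {x : A} {p k : ℕ}
    (h : ∀ i, p ≤ i → i < p + k → Commute x (e i)) : Commute x (desc e p k) := by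
  induction k with
  | zero => exact Commute.one_right _
  | succ k ih =>
    exact (h _ (by omega) (by omega)).mul_right (ih fun i h1 h2 => h i h1 (by omega))

theorem commute_rows {e : ℕ → A} {x : A} {p a j : ℕ}
    (h : ∀ i, p ≤ i → i + 1 < p + a + j → Commute x (e i)) : Commute x (rows e p a j) := by
  induction j with
  | zero => exact Commute.one_right _
  | succ j ih =>
    exact (ih fun i h1 h2 => h i h1 (by omega)).mul_right
      (commute_desc fun i h1 h2 => h i (by omega) (by omega))

theorem rows_add (e : ℕ → A) (p a j k : ℕ) :
    rows e p a (j + k) = rows e p a j * rows e (p + j) a k := by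
  induction k with
  | zero => simp [rows]
  | succ k ih => rw [← add_assoc, rows, ih, rows, mul_assoc, add_assoc]

theorem rows_succ' (e : ℕ → A) (p a j : ℕ) :
    rows e p a (j + 1) = desc e p a * rows e (p + 1) a j := by
  rw [add_comm, rows_add]
  simp [rows]

end Words

/-! ### The Temperley--Lieb relations -/

/-- The relations of the Temperley--Lieb algebra on `N` strands with loop value `-[2]`. -/
structure TLRel {A : Type*} [Ring A] [Algebra K A] (N : ℕ) (e : ℕ → A) : Prop where
  sq : ∀ i, e i * e i = (-qInt 2) • e i
  comm : ∀ i j, i + 2 ≤ j → Commute (e i) (e j)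
  down : ∀ i, e (i + 1) * e i * e (i + 1) = e (i + 1)
  up : ∀ i, i + 2 < N → e i * e (i + 1) * e i = e i

variable {A : Type*} [Ring A] [Algebra K A]

/-- The lower clasp of a pair is a projector in the shifted generators. -/
theorem TLRel.shift {N : ℕ} {e : ℕ → A} (h : TLRel N e) (s : ℕ) :
    TLRel (N - s) (fun i => e (s + i)) where
  sq i := h.sq _
  comm i j hij := h.comm _ _ (by omega)
  down i := h.down _
  up i hi := h.up _ (by omega)

/-- The Jones--Wenzl projectors in terms of the generators of the Temperley--Lieb algebra. -/
def jw (e : ℕ → A) : ℕ → A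
  | 0 => 1
  | 1 => 1
  | k + 2 => jw e (k + 1) + (qInt (k + 1) / qInt (k + 2)) • (jw e (k + 1) * e k * jw e (k + 1))

theorem TLRel.commute_jw {N : ℕ} {e : ℕ → A} (h : TLRel N e) :
    ∀ k m, k ≤ m → Commute (jw e k) (e m)
  | 0, _, _ => Commute.one_left _
  | 1, _, _ => Commute.one_left _
  | k + 2, m, hk => by
    have h1 := h.commute_jw (k + 1) m (by omega)
    exact h1.add_left (((h1.mul_left (h.comm k m hk)).mul_left h1).smul_left _)

/-- The five properties support each other in one induction. The last is the partial trace in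
algebraic form. Its scalar is minus the inverse of the coefficient in the next step of `jw`, and
this is exactly what makes the next projector annihilate `e k`; annihilation then gives idempotence.
-/
theorem TLRel.jw_spec {N : ℕ} {e : ℕ → A} (h : TLRel N e) (k : ℕ) :
    jw e (k + 1) * jw e (k + 1) = jw e (k + 1) ∧ jw e k * jw e (k + 1) = jw e (k + 1) ∧
    jw e (k + 1) * jw e k = jw e (k + 1) ∧
    (∀ m, m + 1 ≤ k → e m * jw e (k + 1) = 0 ∧ jw e (k + 1) * e m = 0) ∧
    e k * jw e (k + 1) * e k = (-(qInt (k + 2) / qInt (k + 1))) • (jw e k * e k) := by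
  induction k with
  | zero =>
    refine ⟨by simp [jw], by simp [jw], by simp [jw], fun m hm => by omega, ?_⟩
    simp [jw, h.sq, qInt_one]
  | succ k ih =>
    obtain ⟨h1, h2, h3, h4, h5⟩ := ih
    have hc1 : qInt ((k : ℤ) + 1) ≠ 0 := by exact_mod_cast qInt_ne_zero (Nat.succ_ne_zero k)
    have hc2 : qInt ((k : ℤ) + 2) ≠ 0 := by
      exact_mod_cast qInt_ne_zero (Nat.succ_ne_zero (k + 1))
    have hf : jw e (k + 1 + 1) = jw e (k + 1) + (qInt (k + 1) / qInt (k + 2)) •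
      (jw e (k + 1) * e k * jw e (k + 1)) := rfl
    have hck : Commute (jw e k) (e k) := h.commute_jw k k le_rfl
    have hck1 : Commute (jw e (k + 1)) (e (k + 1)) := h.commute_jw _ _ le_rfl
    set f := jw e (k + 1)
    set g := jw e k
    set c := qInt ((k : ℤ) + 1) / qInt ((k : ℤ) + 2) with hc
    have hcc : c * (-(qInt ((k : ℤ) + 2) / qInt ((k : ℤ) + 1))) = -1 := by
      rw [hc]; field_simp
    set d := -(qInt ((k : ℤ) + 2) / qInt ((k : ℤ) + 1))
    have l1 : e k * f * e k * f = d • (e k * f) := by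
      rw [h5, smul_mul_assoc, hck.eq, mul_assoc, h2]
    have l2 : f * e k * f * e k = d • (f * e k) := by
      rw [mul_assoc, mul_assoc, ← mul_assoc (e k), h5, mul_smul_comm, ← mul_assoc, h3]
    have a1 : f * jw e (k + 1 + 1) = jw e (k + 1 + 1) := by
      rw [hf, mul_add, h1, mul_smul_comm, mul_assoc f (e k), ← mul_assoc f f, h1]
    have a2 : jw e (k + 1 + 1) * f = jw e (k + 1 + 1) := by
      rw [hf, add_mul, h1, smul_mul_assoc, mul_assoc (f * e k), h1]
    have z1 : e k * jw e (k + 1 + 1) = 0 := by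
      rw [hf, mul_add, mul_smul_comm, ← mul_assoc, ← mul_assoc, l1, smul_smul, hcc]
      simp
    have z2 : jw e (k + 1 + 1) * e k = 0 := by
      rw [hf, add_mul, smul_mul_assoc, l2, smul_smul, hcc]
      simp
    refine ⟨?_, a1, a2, ?_, ?_⟩
    · nth_rewrite 1 [hf]
      rw [add_mul, a1, smul_mul_assoc, mul_assoc, a1, mul_assoc, z1]
      simp
    · intro m hm
      rcases Nat.lt_or_eq_of_le (show m ≤ k by omega) with hm | rfl
      · obtain ⟨p1, p2⟩ := h4 m hm
        constructor
        · rw [← a1, ← mul_assoc, p1, zero_mul]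
        · rw [← a2, mul_assoc, p2, mul_zero]
      · exact ⟨z1, z2⟩
    -- The first summand contributes `-[2]`, the second its coefficient `c` by `e (k+1) * e k * e
    -- (k+1) = e (k+1)`; the recursion for quantum integers combines them.
    · rw [hf, mul_add, add_mul, ← hck1.eq, mul_smul_comm, smul_mul_assoc, mul_assoc f, h.sq]
      have : e (k + 1) * (f * e k * f) * e (k + 1) = f * e (k + 1) := by
        calc _ = (e (k + 1) * f) * e k * (f * e (k + 1)) := by simp only [mul_assoc]
          _ = (f * e (k + 1)) * e k * (e (k + 1) * f) :=
            congrArg₂ (fun x y => x * e k * y) hck1.eq.symm hck1.eq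
          _ = f * (e (k + 1) * e k * e (k + 1)) * f := by simp only [mul_assoc]
          _ = f * e (k + 1) := by rw [h.down, mul_assoc, ← hck1.eq, ← mul_assoc, h1]
      rw [this, mul_smul_comm, ← add_smul]
      congr 1
      have := qInt_add_two ((k : ℤ) + 1)
      rw [show (k : ℤ) + 1 + 1 = k + 2 by ring] at this
      push_cast
      rw [this, show (k : ℤ) + 1 + 1 = k + 2 by ring, hc]
      field_simp
      ring

theorem TLRel.mul_jw {N : ℕ} {e : ℕ → A} (h : TLRel N e) {k m : ℕ} (hm : m + 2 ≤ k) :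
    e m * jw e k = 0 := by
  obtain ⟨k, rfl⟩ := Nat.exists_eq_add_of_le' (show 1 ≤ k by omega)
  exact ((h.jw_spec k).2.2.2.1 m (by omega)).1

theorem TLRel.jw_mul {N : ℕ} {e : ℕ → A} (h : TLRel N e) {k m : ℕ} (hm : m + 2 ≤ k) :
    jw e k * e m = 0 := by
  obtain ⟨k, rfl⟩ := Nat.exists_eq_add_of_le' (show 1 ≤ k by omega)
  exact ((h.jw_spec k).2.2.2.1 m (by omega)).2

/-- A crossing of two strands. -/
def sig (e : ℕ → A) (i : ℕ) : A := t • (1 : A) + t⁻¹ • e i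

/-- A bundle of `n` strands crossing over a bundle of `l` strands. -/
def bundle (e : ℕ → A) (n : ℕ) : ℕ → A
  | 0 => 1
  | l + 1 => bundle e n l * desc (sig e) l n

theorem commute_sig {e : ℕ → A} {x : A} {i : ℕ} (h : Commute x (e i)) : Commute x (sig e i) :=
  ((Commute.one_right x).smul_right _).add_right (h.smul_right _)


end A1Web

end

noncomputable section

namespace A1Web

variable {A : Type*} [Ring A] [Algebra K A]

/-! ### Moving generators through words -/

/-- The base case is `e_i e_{i+1} e_i = e_i`. In the induction the new top generator of the longer
word commutes to the left through the old shorter word, and back again after the exchange. -/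
theorem TLRel.desc_mul_desc {N : ℕ} {e : ℕ → A} (h : TLRel N e) (p r i : ℕ)
    (hN : p + r + i + 2 < N) :
    desc e (p + r) (i + 1) * desc e p (r + i + 2) =
      desc e p (r + i + 1) * desc e (p + r + 2) i := by
  induction i with
  | zero =>
    simp only [desc, mul_one, add_zero]
    rw [← mul_assoc, ← mul_assoc, ← add_assoc p r 1, h.up _ (by omega)]
  | succ i ih =>
    have c1 : Commute (e (p + r + i + 2)) (desc e (p + r) (i + 1)) :=
      commute_desc fun m _ h2 => (h.comm _ _ (by omega)).symm
    have c2 : Commute (e (p + r + i + 2)) (desc e p (r + i + 1)) :=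
      commute_desc fun m _ h2 => (h.comm _ _ (by omega)).symm
    have e1 : desc e p (r + (i + 1) + 2) = e (p + r + i + 2) * desc e p (r + i + 2) := by
      rw [show r + (i + 1) + 2 = (r + i + 2) + 1 by omega, desc]
      congr 2; omega
    have e2 : desc e p (r + (i + 1) + 1) = e (p + r + i + 1) * desc e p (r + i + 1) := by
      rw [show r + (i + 1) + 1 = (r + i + 1) + 1 by omega, desc]
      congr 2; omega
    have e3 : desc e (p + r + 2) (i + 1) = e (p + r + i + 2) * desc e (p + r + 2) i := by
      rw [desc]
      congr 2; omega
    calc _ = e (p + r + i + 1) * (desc e (p + r) (i + 1) * e (p + r + i + 2)) *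
          desc e p (r + i + 2) := by
          rw [e1, desc, ← add_assoc (p + r) i 1]; simp only [mul_assoc]
      _ = e (p + r + i + 1) * e (p + r + i + 2) *
          (desc e (p + r) (i + 1) * desc e p (r + i + 2)) := by
          rw [← c1.eq]; simp only [mul_assoc]
      _ = e (p + r + i + 1) * (e (p + r + i + 2) * desc e p (r + i + 1)) *
          desc e (p + r + 2) i := by
          rw [ih (by omega)]; simp only [mul_assoc]
      _ = _ := by
          rw [c2.eq, e2, e3]; simp only [mul_assoc]

/-- In passing a row, the word loses one generator and its lowest index rises by two, while the row
loses its top generator. For `s = 0` the rows absorb the word completely; otherwise a remainder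
emerges on the right. -/
theorem TLRel.desc_mul_rows {N : ℕ} {e : ℕ → A} (h : TLRel N e) (p a q s j : ℕ)
    (hq : q + (j + s) + 1 = p + a) (hp : p ≤ q) (hN : p + a + j ≤ N) :
    desc e q (j + s) * rows e p a j = rows e p (a - 1) j * desc e (q + 2 * j) s := by
  induction j generalizing s with
  | zero => simp [rows]
  | succ j ih =>
    have h1 := ih (s + 1) (by omega) (by omega)
    rw [show j + 1 + s = j + (s + 1) by omega, rows, ← mul_assoc, h1]
    obtain ⟨r, hr⟩ := Nat.exists_eq_add_of_le (show p + j ≤ q + 2 * j by omega)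
    have h2 := h.desc_mul_desc (p + j) r s (by omega)
    rw [hr, mul_assoc, show a = r + s + 2 by omega, h2, ← mul_assoc, rows]
    congr 2
    omega

/-- Both sides collapse to `a * b`: the other coefficient is `s ^ 2 + d + r ^ 2` once `r * s = 1` is
used, and the loop value `d` is the one that makes it vanish. -/
theorem skein_slide {R B : Type*} [CommRing R] [Ring B] [Algebra R B] {a b : B} {s r d : R}
    (hs : r * s = 1) (hd : d = -(s ^ 2 + r ^ 2)) (ha : a * a = d • a) (hb : b * b = d • b)
    (hab : a * (b * a) = a) (hba : b * (a * b) = b) :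
    (s • (1 : B) + r • b) * (s • (1 : B) + r • a) * b =
      a * ((s • (1 : B) + r • b) * (s • (1 : B) + r • a)) := by
  have hc : s * s + d + r * r = 0 := by rw [hd]; ring
  have h1 : (s • (1 : B) + r • b) * (s • (1 : B) + r • a) * b = a * b := by
    simp only [add_mul, mul_add, smul_mul_assoc, mul_smul_comm, one_mul, mul_one, mul_assoc,
      hb, hba, smul_smul, smul_add]
    trans (s * s + (r * s) * d + r * r) • b + (r * s) • (a * b)
    · module
    · rw [hs, one_mul, hc, zero_smul, one_smul, zero_add]
  have h2 : a * ((s • (1 : B) + r • b) * (s • (1 : B) + r • a)) = a * b := by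
    simp only [add_mul, mul_add, smul_mul_assoc, mul_smul_comm, one_mul, mul_one,
      ha, hab, smul_smul, smul_add]
    trans (s * s + (r * s) * d + r * r) • a + (r * s) • (a * b)
    · module
    · rw [hs, one_mul, hc, zero_smul, one_smul, zero_add]
  rw [h1, h2]

theorem TLRel.sig_slide {N : ℕ} {e : ℕ → A} (h : TLRel N e) {m : ℕ} (hm : m + 2 < N) :
    sig e (m + 1) * sig e m * e (m + 1) = e m * (sig e (m + 1) * sig e m) := by
  refine skein_slide (inv_mul_cancel₀ t_ne_zero) (by rw [qInt_two]) (h.sq m) (h.sq (m + 1)) ?_ ?_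
  · rw [← mul_assoc, h.up m hm]
  · rw [← mul_assoc, h.down m]

theorem TLRel.desc_sig_slide {N : ℕ} {e : ℕ → A} (h : TLRel N e) {p k m : ℕ} (hp : p ≤ m)
    (hm : m + 2 ≤ p + k) (hN : m + 2 < N) :
    desc (sig e) p k * e (m + 1) = e m * desc (sig e) p k := by
  obtain ⟨r, rfl⟩ := Nat.exists_eq_add_of_le hp
  obtain ⟨s, rfl⟩ := Nat.exists_eq_add_of_le (show r + 2 ≤ k by omega)
  have c1 : Commute (e (p + r + 1)) (desc (sig e) p r) :=
    commute_desc fun i _ hi => commute_sig (h.comm _ _ (by omega)).symm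
  have c2 : Commute (e (p + r)) (desc (sig e) (p + (r + 2)) s) :=
    commute_desc fun i _ hi => commute_sig (h.comm _ _ (by omega))
  have e1 : desc (sig e) p (r + 2) = sig e (p + r + 1) * sig e (p + r) * desc (sig e) p r := by
    simp only [desc, ← add_assoc, mul_assoc]
  rw [desc_add, e1]
  calc _ = desc (sig e) (p + (r + 2)) s * (sig e (p + r + 1) * sig e (p + r)) *
        (desc (sig e) p r * e (p + r + 1)) := by simp only [mul_assoc]
    _ = desc (sig e) (p + (r + 2)) s * (sig e (p + r + 1) * sig e (p + r) * e (p + r + 1)) *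
        desc (sig e) p r := by rw [← c1.eq]; simp only [mul_assoc]
    _ = (desc (sig e) (p + (r + 2)) s * e (p + r)) * (sig e (p + r + 1) * sig e (p + r)) *
        desc (sig e) p r := by rw [h.sig_slide hN]; simp only [mul_assoc]
    _ = _ := by rw [← c2.eq]; simp only [mul_assoc]

/-- A turnback between adjacent over strands slides past all `l` under strands, which shifts its
place by `l`. -/
theorem TLRel.bundle_slide {N : ℕ} {e : ℕ → A} (h : TLRel N e) {n l m : ℕ} (hm : m + 2 ≤ n)
    (hN : l + n ≤ N) : bundle e n l * e (m + l) = e m * bundle e n l := by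
  induction l with
  | zero => simp [bundle]
  | succ l ih =>
    rw [bundle, mul_assoc, ← add_assoc, h.desc_sig_slide (by omega) (by omega) (by omega),
      ← mul_assoc, ih (by omega), mul_assoc]

theorem TLRel.commute_bundle {N : ℕ} {e : ℕ → A} (h : TLRel N e) {n l m : ℕ} (hm : n + l ≤ m) :
    Commute (e m) (bundle e n l) := by
  induction l with
  | zero => exact Commute.one_right _
  | succ l ih =>
    exact (ih (by omega)).mul_right
      (commute_desc fun i _ hi => commute_sig (h.comm _ _ (by omega)).symm)

theorem sig_mul_of_kill {e : ℕ → A} {i : ℕ} {u : A} (h : e i * u = 0) : sig e i * u = t • u := by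
  simp [sig, add_mul, h]

theorem mul_sig_of_kill {e : ℕ → A} {i : ℕ} {u : A} (h : u * e i = 0) : u * sig e i = t • u := by
  simp [sig, mul_add, h]

theorem desc_sig_mul_of_kill {e : ℕ → A} {p k : ℕ} {u : A}
    (h : ∀ m, p ≤ m → m < p + k → e m * u = 0) : desc (sig e) p k * u = t ^ k • u := by
  induction k with
  | zero => simp [desc]
  | succ k ih =>
    rw [desc, mul_assoc, ih fun m h1 h2 => h m h1 (by omega), mul_smul_comm,
      sig_mul_of_kill (h _ (by omega) (by omega)), smul_smul, pow_succ]

theorem mul_desc_sig_of_kill {e : ℕ → A} {p k : ℕ} {u : A}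
    (h : ∀ m, p ≤ m → m < p + k → u * e m = 0) : u * desc (sig e) p k = t ^ k • u := by
  induction k with
  | zero => simp [desc]
  | succ k ih =>
    rw [desc, ← mul_assoc, mul_sig_of_kill (h _ (by omega) (by omega)), smul_mul_assoc,
      ih fun m h1 h2 => h m h1 (by omega), smul_smul, pow_succ, mul_comm]

/-- Only the top generator can act first. After `i` consecutive generators have been taken from the
top, only the next one down can act without giving zero; once an identity is chosen, all lower
crossings act as `t`. A choice of `i` generators therefore has weight `t ^ (L - i) * t ^ (-i)`. -/
theorem TLRel.mul_desc_sig {N : ℕ} {e : ℕ → A} (h : TLRel N e) {p L : ℕ} {v : A}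
    (hv : ∀ m, p ≤ m → m + 1 < p + L → v * e m = 0) :
    v * desc (sig e) p L = ∑ i ∈ Finset.range (L + 1),
      t ^ ((L : ℤ) - 2 * i) • (v * desc e (p + L - i) i) := by
  induction L generalizing v with
  | zero => simp [desc]
  | succ L ih =>
    have h1 : v * e (p + L) * desc (sig e) p L = _ := ih (v := v * e (p + L)) (by
      intro m h1 h2
      rw [mul_assoc, ← (h.comm m (p + L) (by omega)).eq, ← mul_assoc, hv m h1 (by omega), zero_mul])
    have h2 : v * desc (sig e) p L = t ^ L • v :=
      mul_desc_sig_of_kill fun m h1 h2 => hv m h1 (by omega)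
    rw [Finset.sum_range_succ', show desc (sig e) p (L + 1) = sig e (p + L) * desc (sig e) p L from rfl,
      ← mul_assoc, sig, mul_add, add_mul, mul_smul_comm, mul_one,
      smul_mul_assoc, h2, mul_smul_comm, smul_mul_assoc, h1, add_comm, Finset.smul_sum]
    congr 1
    · refine Finset.sum_congr rfl fun i hi => ?_
      have hi : i < L + 1 := Finset.mem_range.1 hi
      rw [smul_smul, mul_assoc, show p + (L + 1) - (i + 1) = p + L - i by omega, desc,
        show p + L - i + i = p + L by omega]
      congr 1
      rw [← zpow_neg_one, ← zpow_add₀ t_ne_zero]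
      congr 1; push_cast; ring
    · simp only [desc, mul_one, smul_smul]
      congr 1
      rw [← pow_succ', ← zpow_natCast]
      congr 1

/-! ### The crossing of two clasped bundles -/

section Crossing

variable {n : ℕ} {e : ℕ → A} {f : A}

theorem TLRel.crossing_step (h : TLRel (2 * n) e)
    (hl : ∀ m, m + 1 ≠ n → m + 2 ≤ 2 * n → f * e m = 0)
    (hr : ∀ m, m + 1 ≠ n → m + 2 ≤ 2 * n → e m * f = 0) {l j : ℕ} (hlj : l + 1 + j ≤ n) :
    f * bundle e n (l + 1) * rows e (n - j) (l + 1 + j) j * f =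
      t ^ ((n : ℤ) - 2 * j) • (f * bundle e n l * rows e (n - j) (l + j) j * f) +
      t ^ ((n : ℤ) - 2 * (l + j + 1)) •
        (f * bundle e n l * rows e (n - (j + 1)) (l + (j + 1)) (j + 1) * f) := by
  set v := f * bundle e n l with hv
  set R := rows e (n - j) (l + 1 + j) j * f with hR
  set L := l + j + 1 with hL
  -- The `n` crossings of the strand being resolved split at height `p`: the lowest `d` reach the
  -- right clasp and act as scalars, the upper `L` are expanded against the left clasp.
  obtain ⟨p, hp⟩ : ∃ p, n = p + 1 + j := ⟨n - j - 1, by omega⟩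
  obtain ⟨d, hd⟩ : ∃ d, p = l + d := ⟨p - l, by omega⟩
  have hnj : n - j = p + 1 := by omega
  have hnj' : n - (j + 1) = p := by omega
  have vk : ∀ m, p ≤ m → m + 1 < p + L → v * e m = 0 := by
    intro m h1 h2
    obtain ⟨m', rfl⟩ := Nat.exists_eq_add_of_le' (show l ≤ m by omega)
    rw [hv, mul_assoc, h.bundle_slide (by omega) (by omega), ← mul_assoc,
      hl _ (by omega) (by omega), zero_mul]
  have rk : ∀ m, l ≤ m → m < l + d → e m * R = 0 := by
    intro m h1 h2
    have c : Commute (e m) (rows e (n - j) (l + 1 + j) j) :=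
      commute_rows fun i h3 _ => h.comm _ _ (by omega)
    rw [hR, ← mul_assoc, c.eq, mul_assoc, hr _ (by omega) (by omega), mul_zero]
  have s1 : desc (sig e) l n = desc (sig e) p L * desc (sig e) l d := by
    rw [show n = d + L by omega, desc_add, hd]
  -- With all `L` generators chosen the word is a new first row, that is, a new turnback.
  have top : ∀ i, L = i → v * desc e (p + L - i) i * R =
      v * rows e (n - (j + 1)) (l + (j + 1)) (j + 1) * f := by
    rintro i rfl
    rw [hnj', rows_succ', hR, hnj, show p + L - L = p by omega, show l + (j + 1) = L by omega,
      show l + 1 + j = L by omega]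
    simp only [mul_assoc]
  -- A word of length exactly `j` is absorbed, shortening each of the `j` rows by one.
  have mid : v * desc e (p + L - j) j * R = v * rows e (n - j) (l + j) j * f := by
    have := h.desc_mul_rows (p + 1) (l + 1 + j) (p + L - j) 0 j (by omega) (by omega) (by omega)
    rw [hR, hnj, mul_assoc, ← mul_assoc (desc e (p + L - j) j), add_zero] at *
    rw [this, desc, mul_one, show l + 1 + j - 1 = l + j by omega]
    simp only [mul_assoc]
  -- A shorter word is used up by the first `i` rows. The top generator of the next row then
  -- commutes left through the shortened rows and the bundle, into the left clasp.
  have low : ∀ i, i < j → v * desc e (p + L - i) i * R = 0 := by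
    intro i hi
    have h1 := h.desc_mul_rows (p + 1) (l + 1 + j) (p + L - i) 0 i (by omega) (by omega) (by omega)
    obtain ⟨k, hk⟩ : ∃ k, j = i + (k + 1) := ⟨j - i - 1, by omega⟩
    have c1 : Commute (e (p + L + i)) (rows e (p + 1) (l + 1 + j - 1) i) :=
      commute_rows fun r h3 h4 => (h.comm _ _ (by omega)).symm
    have c2 : Commute (e (p + L + i)) (bundle e n l) := h.commute_bundle (by omega)
    have c3 : v * e (p + L + i) = 0 := by
      rw [hv, mul_assoc, ← c2.eq, ← mul_assoc, hl _ (by omega) (by omega), zero_mul]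
    have h2' : ∀ b, rows e (p + 1) (b + 1) (i + (k + 1)) = rows e (p + 1) (b + 1) i *
        (e (p + 1 + i + b) * (desc e (p + 1 + i) b * rows e (p + 1 + i + 1) (b + 1) k)) := by
      intro b
      rw [rows_add, rows_succ']
      simp only [desc, mul_assoc]
    have h2 : rows e (p + 1) (l + 1 + j) j = rows e (p + 1) (l + 1 + j) i *
        (e (p + L + i) * (desc e (p + 1 + i) (l + j) *
          rows e (p + 1 + i + 1) (l + 1 + j) k)) := by
      have := h2' (l + j)
      rwa [← hk, show l + j + 1 = l + 1 + j by omega,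
        show p + 1 + i + (l + j) = p + L + i by omega] at this
    rw [add_zero, desc, mul_one] at h1
    rw [hR, hnj, h2]
    calc _ = v * (desc e (p + L - i) i * rows e (p + 1) (l + 1 + j) i) * e (p + L + i) *
          (desc e (p + 1 + i) (l + j) * rows e (p + 1 + i + 1) (l + 1 + j) k * f) := by
          simp only [mul_assoc]
      _ = v * (rows e (p + 1) (l + 1 + j - 1) i * e (p + L + i)) *
          (desc e (p + 1 + i) (l + j) * rows e (p + 1 + i + 1) (l + 1 + j) k * f) := by
          rw [h1]; simp only [mul_assoc]
      _ = 0 := by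
          rw [← c1.eq, ← mul_assoc v, c3, zero_mul, zero_mul]
  -- A longer word leaves a remainder behind all the rows. Its lowest generator meets the right
  -- clasp; its index differs from `n - 1` because `i < L`.
  have high : ∀ i, j < i → i < L → v * desc e (p + L - i) i * R = 0 := by
    intro i h1 h2
    obtain ⟨s, rfl⟩ : ∃ s, i = j + (s + 1) := ⟨i - j - 1, by omega⟩
    have h3 := h.desc_mul_rows (p + 1) (l + 1 + j) (p + L - (j + (s + 1))) (s + 1) j (by omega)
      (by omega) (by omega)
    have h4 := hr (p + L - (j + (s + 1)) + 2 * j) (by omega) (by omega)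
    rw [hR, hnj, mul_assoc, ← mul_assoc (desc e _ _), h3, desc_succ']
    simp only [mul_assoc, h4, mul_zero]
  have lhs : f * bundle e n (l + 1) * rows e (n - j) (l + 1 + j) j * f =
      t ^ d • (v * desc (sig e) p L * R) := by
    rw [bundle, s1, mul_assoc _ _ f, ← hR, ← mul_assoc f, ← hv, ← mul_assoc v, mul_assoc _ _ R,
      desc_sig_mul_of_kill rk, mul_smul_comm]
  rw [lhs, h.mul_desc_sig vk, Finset.sum_mul, Finset.sum_range_succ, Finset.sum_eq_single j]
  · rw [smul_mul_assoc, smul_mul_assoc, mid, top L rfl, smul_add, smul_smul, smul_smul]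
    congr 2
    · rw [← zpow_natCast, ← zpow_add₀ t_ne_zero]; congr 1; push_cast [hp, hd, hL]; ring
    · rw [← zpow_natCast, ← zpow_add₀ t_ne_zero]; congr 1; push_cast [hp, hd, hL]; ring
  · intro i hi hij
    have hi : i < L := Finset.mem_range.1 hi
    rw [smul_mul_assoc]
    rcases Nat.lt_or_gt_of_ne hij with h1 | h1
    · rw [low i h1, smul_zero]
    · rw [high i h1 hi, smul_zero]
  · intro hj
    exact absurd (Finset.mem_range.2 (by omega)) hj

end Crossing

/-! ### Quantum binomial coefficients -/

theorem qPoch_succ (k : ℕ) : qPoch (k + 1) = qPoch k * (1 - q ^ (k + 1)) := by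
  rw [qPoch, Finset.prod_Icc_succ_top (by omega), qPoch]

theorem one_sub_q_pow_ne_zero (k : ℕ) : 1 - q ^ (k + 1) ≠ 0 := by
  intro h
  have h1 : q ^ (k + 1) = 1 := (sub_eq_zero.1 h).symm
  rw [q, ← pow_mul] at h1
  exact t_pow_ne_one (by omega) h1

theorem qPoch_ne_zero (k : ℕ) : qPoch k ≠ 0 := by
  induction k with
  | zero => simp [qPoch]
  | succ k ih => rw [qPoch_succ]; exact mul_ne_zero ih (one_sub_q_pow_ne_zero k)

theorem qPoch_zero : qPoch 0 = 1 := by simp [qPoch]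

theorem qBinom_zero (s : ℕ) : qBinom s 0 = 1 := by
  simp [qBinom, qPoch_zero, qPoch_ne_zero]

theorem qBinom_self (s : ℕ) : qBinom s s = 1 := by
  simp [qBinom, qPoch_zero, qPoch_ne_zero]

theorem qBinom_succ_succ {s j : ℕ} (h : j ≤ s) :
    qBinom (s + 1) (j + 1) = qBinom s (j + 1) + q ^ (s - j) * qBinom s j := by
  rcases Nat.lt_or_eq_of_le h with h | rfl
  · obtain ⟨d, rfl⟩ := Nat.exists_eq_add_of_le h
    rw [qBinom, if_pos (by omega), qBinom, if_pos (by omega), qBinom, if_pos (by omega),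
      show j + 1 + d + 1 - (j + 1) = d + 1 by omega, show j + 1 + d - (j + 1) = d by omega,
      show j + 1 + d - j = d + 1 by omega, qPoch_succ (j + 1 + d), qPoch_succ d, qPoch_succ j]
    have h1 := qPoch_ne_zero j
    have h2 := qPoch_ne_zero d
    have h3 := one_sub_q_pow_ne_zero j
    have h4 := one_sub_q_pow_ne_zero d
    field_simp
    ring
  · rw [qBinom_self, qBinom_self, qBinom, if_neg (by omega)]
    simp

theorem qBinom_symm {s j : ℕ} (h : j ≤ s) : qBinom s (s - j) = qBinom s j := by
  rw [qBinom, if_pos (by omega), qBinom, if_pos h, Nat.sub_sub_self h, mul_comm]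

/-! ### The recursion over resolved under strands -/

/-- The coefficients of the partial resolutions of a crossing of two bundles of `n` strands. -/
def crossCoeff (n s j : ℕ) : K := t ^ ((n : ℤ) * s - 2 * n * j - 2 * j * (s - j)) * qBinom s j

theorem crossCoeff_zero (n s : ℕ) :
    crossCoeff n (s + 1) 0 = crossCoeff n s 0 * t ^ ((n : ℤ) - 2 * (0 : ℕ)) := by
  simp only [crossCoeff, qBinom_zero, mul_one]
  rw [← zpow_add₀ t_ne_zero]
  congr 1; push_cast; ring

/-- This is the q-Pascal rule: the factor `q ^ (s - j) = t ^ (4 * (s - j))` is the discrepancy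
between the exponents of the two ways to reach `j + 1` turnbacks. -/
theorem crossCoeff_succ {n s j : ℕ} (hs : s < n) (hj : j ≤ s) :
    crossCoeff n (s + 1) (j + 1) =
      crossCoeff n s (j + 1) * t ^ ((n : ℤ) - 2 * (j + 1 : ℕ)) +
      crossCoeff n s j * t ^ ((n : ℤ) - 2 * ((n - s - 1 : ℕ) + j + 1)) := by
  simp only [crossCoeff]
  have hq : q ^ (s - j) = t ^ (4 * ((s : ℤ) - j)) := by
    rw [q, ← pow_mul, ← zpow_natCast]
    congr 1; push_cast [Nat.cast_sub hj]; ring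
  have hn : ((n - s - 1 : ℕ) : ℤ) = n - s - 1 := by omega
  have e1 : t ^ ((n : ℤ) * (s + 1 : ℕ) - 2 * n * (j + 1 : ℕ) -
      2 * (j + 1 : ℕ) * ((s + 1 : ℕ) - (j + 1 : ℕ))) =
      t ^ ((n : ℤ) * s - 2 * n * (j + 1 : ℕ) - 2 * (j + 1 : ℕ) * (s - (j + 1 : ℕ))) *
        t ^ ((n : ℤ) - 2 * (j + 1 : ℕ)) := by
    rw [← zpow_add₀ t_ne_zero]; congr 1; push_cast; ring
  have e2 : t ^ ((n : ℤ) * (s + 1 : ℕ) - 2 * n * (j + 1 : ℕ) -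
      2 * (j + 1 : ℕ) * ((s + 1 : ℕ) - (j + 1 : ℕ))) * t ^ (4 * ((s : ℤ) - j)) =
      t ^ ((n : ℤ) * s - 2 * n * j - 2 * j * (s - j)) *
        t ^ ((n : ℤ) - 2 * ((n - s - 1 : ℤ) + j + 1)) := by
    rw [← zpow_add₀ t_ne_zero, ← zpow_add₀ t_ne_zero]; congr 1; push_cast; ring
  rw [qBinom_succ_succ hj, hq, hn]
  linear_combination qBinom s (j + 1) * e1 + qBinom s j * e2

theorem crossCoeff_eq_zero (n s : ℕ) : crossCoeff n s (s + 1) = 0 := by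
  simp [crossCoeff, qBinom]

theorem TLRel.crossing_partial {n : ℕ} {e : ℕ → A} {f : A} (h : TLRel (2 * n) e)
    (hl : ∀ m, m + 1 ≠ n → m + 2 ≤ 2 * n → f * e m = 0)
    (hr : ∀ m, m + 1 ≠ n → m + 2 ≤ 2 * n → e m * f = 0) {s : ℕ} (hs : s ≤ n) :
    f * bundle e n n * f = ∑ j ∈ Finset.range (s + 1), crossCoeff n s j •
      (f * bundle e n (n - s) * rows e (n - j) (n - s + j) j * f) := by
  induction s with
  | zero => simp [crossCoeff, qBinom_zero, rows]
  | succ s ih =>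
    obtain ⟨l, hl'⟩ : ∃ l, n - s = l + 1 := ⟨n - s - 1, by omega⟩
    have hl2 : n - (s + 1) = l := by omega
    have hl3 : n - s - 1 = l := by omega
    set G : ℕ → A := fun j => f * bundle e n l * rows e (n - j) (l + j) j * f with hG
    have step : ∀ j ∈ Finset.range (s + 1), crossCoeff n s j •
        (f * bundle e n (n - s) * rows e (n - j) (n - s + j) j * f) =
        (crossCoeff n s j * t ^ ((n : ℤ) - 2 * j)) • G j +
        (crossCoeff n s j * t ^ ((n : ℤ) - 2 * ((n - s - 1 : ℕ) + j + 1))) • G (j + 1) := by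
      intro j hj
      have hj : j < s + 1 := Finset.mem_range.1 hj
      rw [hl3, hl', h.crossing_step hl hr (by omega), smul_add, smul_smul, smul_smul]
    rw [ih (by omega), Finset.sum_congr rfl step, Finset.sum_add_distrib, hl2]
    change _ = ∑ j ∈ Finset.range (s + 1 + 1), crossCoeff n (s + 1) j • G j
    -- The added term is zero; it makes the sum without a new turnback as long as the target sum, so
    -- that the two contributions can be matched index by index.
    have ext : ∑ j ∈ Finset.range (s + 1), (crossCoeff n s j * t ^ ((n : ℤ) - 2 * j)) • G j =
        ∑ j ∈ Finset.range (s + 1 + 1), (crossCoeff n s j * t ^ ((n : ℤ) - 2 * j)) • G j := by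
      rw [Finset.sum_range_succ _ (s + 1), crossCoeff_eq_zero, zero_mul, zero_smul, add_zero]
    rw [ext, Finset.sum_range_succ', Finset.sum_range_succ' _ (s + 1), crossCoeff_zero,
      add_right_comm, ← Finset.sum_add_distrib]
    congr 1
    refine Finset.sum_congr rfl fun j hj => ?_
    have hj : j < s + 1 := Finset.mem_range.1 hj
    rw [← add_smul, crossCoeff_succ (by omega) (by omega)]

/-- The crossing of two clasped bundles of `n` strands. -/
theorem TLRel.crossing {n : ℕ} {e : ℕ → A} {f : A} (h : TLRel (2 * n) e)
    (hl : ∀ m, m + 1 ≠ n → m + 2 ≤ 2 * n → f * e m = 0)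
    (hr : ∀ m, m + 1 ≠ n → m + 2 ≤ 2 * n → e m * f = 0) :
    f * bundle e n n * f = ∑ k : Fin (n + 1),
      (t ^ (-(n : ℤ) ^ 2 + 2 * ((k : ℕ) : ℤ) ^ 2) * qBinom n k) •
        (f * rows e k (n - k) (n - k) * f) := by
  -- At `s = n` no crossing is left and the index counts turnbacks. Substituting `j = n - k` turns
  -- the exponent `n * n - 2 * n * j - 2 * j * (n - j)` into `-n ^ 2 + 2 * k ^ 2`.
  rw [h.crossing_partial hl hr le_rfl, ← Finset.sum_range_reflect, Finset.sum_range]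
  refine Finset.sum_congr rfl fun k _ => ?_
  have hk : (k : ℕ) ≤ n := Nat.lt_succ_iff.1 k.2
  rw [show n + 1 - 1 - (k : ℕ) = n - k by omega, show n - (n - (k : ℕ)) = k by omega,
    show n - n = 0 by omega, zero_add, bundle, mul_one, crossCoeff, qBinom_symm hk]
  congr 3
  rw [Nat.cast_sub hk]
  ring

end A1Web

end

noncomputable section

namespace A1Web

/-! ### The Temperley--Lieb algebra of webs -/

/-- The identity web on `N` strands. -/
def idWeb (N : ℕ) : W N N := Finsupp.single (strandsWeb rfl) 1

theorem glue_idWeb_left {N M : ℕ} (x : W N M) : glue (idWeb N) x = x := by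
  rw [idWeb, glue_strandsWeb_left, place_zero_zero]

theorem glue_idWeb_right {N M : ℕ} (x : W N M) : glue x (idWeb M) = x := by
  rw [idWeb, glue_strandsWeb_right, place_zero_zero]

/-- The web space of a disk with `N` left and `N` right marked points, as an algebra with side by
side gluing as multiplication. -/
def TL (N : ℕ) : Type := W N N

namespace TL

instance (N : ℕ) : AddCommGroup (TL N) := inferInstanceAs (AddCommGroup (W N N))

instance (N : ℕ) : Module K (TL N) := inferInstanceAs (Module K (W N N))

/-- The web underlying an element of the Temperley--Lieb algebra. -/
def toW {N : ℕ} : TL N ≃ₗ[K] W N N := LinearEquiv.refl K (W N N)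

/-- A web with the same number of points on both sides, as an element of the Temperley--Lieb
algebra. -/
def ofW {N : ℕ} : W N N ≃ₗ[K] TL N := toW.symm

@[simp] theorem toW_ofW {N : ℕ} (x : W N N) : toW (ofW x) = x := rfl

instance (N : ℕ) : Ring (TL N) where
  __ := (inferInstance : AddCommGroup (TL N))
  mul x y := ofW (glue (toW x) (toW y))
  one := ofW (idWeb N)
  left_distrib x y z := by
    change ofW (glue (toW x) (toW (y + z))) = ofW (glue (toW x) (toW y)) + ofW (glue (toW x) (toW z))
    simp only [map_add]
  right_distrib x y z := by
    change ofW (glue (toW (x + y)) (toW z)) = ofW (glue (toW x) (toW z)) + ofW (glue (toW y) (toW z))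
    simp only [map_add, LinearMap.add_apply]
  zero_mul x := by
    change ofW (glue (toW 0) (toW x)) = 0
    simp only [map_zero, LinearMap.zero_apply]
  mul_zero x := by
    change ofW (glue (toW x) (toW 0)) = 0
    simp only [map_zero]
  mul_assoc x y z := congrArg ofW (glue_assoc (toW x) (toW y) (toW z))
  one_mul x := congrArg ofW (glue_idWeb_left (toW x))
  mul_one x := congrArg ofW (glue_idWeb_right (toW x))

theorem toW_mul {N : ℕ} (x y : TL N) : toW (x * y) = glue (toW x) (toW y) := rfl

instance (N : ℕ) : Algebra K (TL N) :=
  Algebra.ofModule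
    (fun r x y => toW.injective (by simp only [toW_mul, map_smul, LinearMap.smul_apply]))
    (fun r x y => toW.injective (by simp only [toW_mul, map_smul]))

end TL

open TL

theorem place_congr {m n a b a' b' N N' : ℕ} (ha : a = a') (hb : b = b') (hm : a + m + b = N)
    (hn : a + n + b = N') (x : W m n) :
    place a b hm hn x = place a' b' (by omega) (by omega) x := by
  subst ha hb; rfl

theorem place_strands {a b m N : ℕ} (hm hn : a + m + b = N) :
    place a b hm hn (bracket (strands m)) = idWeb N := by
  rw [strands, bracket, place_strandsWeb]; rfl

/-- Both sides equal the stack of `x`, the strands of the gap `g`, and `y`. The offsets on the two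
sides differ because `x` and `y` may change the number of strands. -/
theorem place_comm {m n m' n' a b b₁ b₁' a₂ a₂' N M M' N' : ℕ}
    (hm : a + m + b₁ = N) (hn : a + n + b₁ = M) (hm' : a₂ + m' + b = M) (hn' : a₂ + n' + b = N')
    (km' : a₂' + m' + b = N) (kn' : a₂' + n' + b = M') (km : a + m + b₁' = M')
    (kn : a + n + b₁' = N') (hgap : a + n ≤ a₂) (x : W m n) (y : W m' n') :
    glue (place a b₁ hm hn x) (place a₂ b hm' hn' y) =
      glue (place a₂' b km' kn' y) (place a b₁' km kn x) := by
  obtain ⟨g, rfl⟩ := Nat.exists_eq_add_of_le hgap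
  have h1 : place a b₁ hm hn x =
      place a (m' + b) (by omega) (by omega) (stack x (bracket (strands g))) := by
    rw [place_stack a (m' + b) (b₁ := b₁) (a₂ := a + n) (by omega) (by omega) hm hn
      (by omega) (by omega), place_strands, glue_idWeb_right]
  have h2 : place a b₁' km kn x =
      place a (n' + b) (by omega) (by omega) (stack x (bracket (strands g))) := by
    rw [place_stack a (n' + b) (b₁ := b₁') (a₂ := a + n) (by omega) (by omega) km kn
      (by omega) (by omega), place_strands, glue_idWeb_right]
  rw [h1, h2, ← place_stack a b (by omega) (by omega), ← place_stack' a b (by omega) (by omega)]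

/-! ### Turnbacks and the generators of the algebra -/

/-- A turnback on the left at the places `i` and `i + 1`. -/
def capAt (N M i : ℕ) (h : N = M + 2) (hi : i ≤ M) : W N M :=
  place i (M - i) (by omega) (by omega) (bracket .cap)

/-- A turnback on the right at the places `i` and `i + 1`. -/
def cupAt (N M i : ℕ) (h : N = M + 2) (hi : i ≤ M) : W M N :=
  place i (M - i) (by omega) (by omega) (bracket .cup)

/-- The generators of the Temperley--Lieb algebra, continued by zero. -/
def gen (N i : ℕ) : TL N :=
  if h : i + 2 ≤ N then
    ofW (place i (N - i - 2) (by omega) (by omega) (glue (bracket .cap) (bracket .cup)))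
  else 0

theorem place_cap_cup {a b N : ℕ} (hm hn : a + 2 + b = N) :
    place a b hm hn (glue (bracket .cap) (bracket .cup)) = toW (gen N a) := by
  rw [gen, dif_pos (by omega), toW_ofW]
  exact place_congr rfl (by omega) _ _ _

theorem gen_eq {N M i : ℕ} (h : N = M + 2) (hi : i ≤ M) :
    toW (gen N i) = glue (capAt N M i h hi) (cupAt N M i h hi) := by
  rw [capAt, cupAt, ← place_glue, place_cap_cup]

theorem cupAt_capAt_self {N M i : ℕ} (h : N = M + 2) (hi : i ≤ M) :
    glue (cupAt N M i h hi) (capAt N M i h hi) = (-qInt 2) • idWeb M := by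
  rw [capAt, cupAt, ← place_glue _ _ _ _ (by omega), glue_cup_cap, map_smul, emptyDisk,
    place_strandsWeb]
  rfl

theorem cupAt_capAt_succ {N M i : ℕ} (h : N = M + 2) (hi : i + 1 ≤ M) :
    glue (cupAt N M i h (by omega)) (capAt N M (i + 1) h hi) = idWeb M := by
  have h1 : cupAt N M i h (by omega) = place i (M - i - 1) (by omega) (by omega)
      (place 0 1 (by omega) (by omega) (bracket .cup) : W 1 3) := by
    rw [place_place]
    exact place_congr (by omega) (by omega) _ _ _
  have h2 : capAt N M (i + 1) h hi = place i (M - i - 1) (by omega) (by omega)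
      (place 1 0 (by omega) (by omega) (bracket .cap) : W 3 1) := by
    rw [place_place]
    exact place_congr (by omega) (by omega) _ _ _
  rw [h1, h2, ← place_glue _ _ _ _ (by omega), glue_place_cup_place_cap, place_strandsWeb]
  rfl

theorem cupAt_succ_capAt {N M i : ℕ} (h : N = M + 2) (hi : i + 1 ≤ M) :
    glue (cupAt N M (i + 1) h hi) (capAt N M i h (by omega)) = idWeb M := by
  have h1 : capAt N M i h (by omega) = place i (M - i - 1) (by omega) (by omega)
      (place 0 1 (by omega) (by omega) (bracket .cap) : W 3 1) := by
    rw [place_place]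
    exact place_congr (by omega) (by omega) _ _ _
  have h2 : cupAt N M (i + 1) h hi = place i (M - i - 1) (by omega) (by omega)
      (place 1 0 (by omega) (by omega) (bracket .cup) : W 1 3) := by
    rw [place_place]
    exact place_congr (by omega) (by omega) _ _ _
  rw [h1, h2, ← place_glue _ _ _ _ (by omega), glue_place_cup_place_cap', place_strandsWeb]
  rfl

theorem gen_of_lt {N i : ℕ} (h : N < i + 2) : gen N i = 0 := by
  rw [gen, dif_neg (by omega)]

/-- Factoring a generator as a cap followed by a cup reduces the relations between equal or adjacent
indices to a loop or a zigzag. Out of range generators are zero: this is harmless for `down`, but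
`up` needs its bound, since at `i + 2 = N` the factor `e (i + 1)` vanishes while `e i` is a genuine
turnback. -/
theorem tlRel_gen (N : ℕ) : TLRel N (gen N) where
  sq i := by
    by_cases hi : i + 2 ≤ N
    · obtain ⟨M, rfl⟩ := Nat.exists_eq_add_of_le' (show 2 ≤ N by omega)
      refine toW.injective ?_
      rw [toW_mul, map_smul, gen_eq rfl (show i ≤ M by omega), glue_assoc,
        ← glue_assoc (cupAt _ _ _ _ _), cupAt_capAt_self, map_smul, LinearMap.smul_apply,
        glue_idWeb_left, map_smul]
    · rw [gen_of_lt (by omega)]; simp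
  comm i j hij := by
    by_cases hj : j + 2 ≤ N
    · refine toW.injective ?_
      rw [toW_mul, toW_mul, gen, dif_pos (by omega), gen, dif_pos hj, toW_ofW, toW_ofW]
      exact place_comm _ _ _ _ _ _ _ _ (by omega) _ _
    · rw [gen_of_lt (i := j) (by omega)]; exact Commute.zero_right _
  down i := by
    by_cases hi : i + 3 ≤ N
    · obtain ⟨M, rfl⟩ := Nat.exists_eq_add_of_le' (show 2 ≤ N by omega)
      refine toW.injective ?_
      rw [toW_mul, toW_mul, gen_eq rfl (show i ≤ M by omega), gen_eq rfl (show i + 1 ≤ M by omega),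
        glue_assoc, glue_assoc, glue_assoc,
        ← glue_assoc (cupAt _ _ _ _ _) (capAt _ _ _ _ _),
        cupAt_succ_capAt, glue_idWeb_left, ← glue_assoc (cupAt _ _ _ _ _), cupAt_capAt_succ,
        glue_idWeb_left]
    · rw [gen_of_lt (i := i + 1) (by omega)]; simp
  up i hi := by
    obtain ⟨M, rfl⟩ := Nat.exists_eq_add_of_le' (show 2 ≤ N by omega)
    refine toW.injective ?_
    rw [toW_mul, toW_mul, gen_eq rfl (show i ≤ M by omega), gen_eq rfl (show i + 1 ≤ M by omega),
      glue_assoc, glue_assoc, glue_assoc,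
      ← glue_assoc (cupAt _ _ _ _ _) (capAt _ _ _ _ _),
      cupAt_capAt_succ, glue_idWeb_left, ← glue_assoc (cupAt _ _ _ _ _), cupAt_succ_capAt,
      glue_idWeb_left]

/-! ### Brackets of tangles as words in the generators -/

theorem stack_eq_glue {m n m' n' : ℕ} (x : W m n) (y : W m' n') :
    stack x y = glue (place 0 m' (by omega) (by omega) x : W (m + m') (n + m'))
      (place n 0 (by omega) (by omega) y) := by
  rw [← place_zero_zero (by omega) (by omega) (stack x y)]
  exact place_stack 0 0 _ _ _ _ _ _ x y

theorem stack_strands_strands {m n a b : ℕ} (x : W m n) :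
    stack (stack (bracket (strands a)) x) (bracket (strands b)) = place a b rfl rfl x := by
  rw [← place_zero_zero (by omega) (by omega) (stack _ _),
    place_stack 0 0 (b₁ := b) (a₂ := a + n) (N' := a + n + b) _ _ (by omega) (by omega) (by omega)
      (by omega), place_strands, glue_idWeb_right,
    place_stack 0 b (b₁ := m + b) (a₂ := a) (N' := a + m + b) _ _ (by omega) (by omega) (by omega)
      (by omega), place_strands, glue_idWeb_left]

theorem place_overDown {a b N : ℕ} (hm hn : a + 2 + b = N) :
    place a b hm hn (bracket .overDown) = toW (sig (gen N) a) := by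
  -- The turnback smoothing is a cap stacked above a cup; sliding the two apart horizontally gives
  -- the generator.
  have h1 : (Finsupp.single turnWeb 1 : W 2 2) = glue (bracket .cap) (bracket .cup) := by
    have h := stack_eq_glue (bracket .cap) (bracket .cup)
    rw [place_zero_zero, place_zero_zero] at h
    rw [← h, bracket, bracket, stack_single, one_mul]
    rfl
  rw [bracket, map_add, map_smul, map_smul, h1, place_cap_cup, horizontalWeb, place_strandsWeb]
  rfl

theorem place_crossOne (k : ℕ) : ∀ {a b N : ℕ} (hm : a + (k + 1) + b = N) (hn : a + (1 + k) + b = N),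
    place a b hm hn (bracket (crossOne k)) = toW (desc (sig (gen N)) a k) := by
  induction k with
  | zero =>
    intro a b N hm hn
    exact place_strands hm hn
  | succ k ih =>
    intro a b N hm hn
    change place a b hm hn (glue (stack (bracket (strands k)) (bracket .overDown))
      (stack (bracket (crossOne k)) (bracket (strands 1)))) = _
    rw [place_glue a b hm hm hn, place_stack a b (m := k) (n := k) (m' := 2) (n' := 2) (N' := N) (b₁ := 2 + b) (a₂ := a + k) _ _
      (by omega) (by omega) (by omega) (by omega), place_strands, glue_idWeb_left,
      place_overDown, place_stack a b (m := k + 1) (n := 1 + k) (m' := 1) (n' := 1) (N' := N) (b₁ := 1 + b)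
        (a₂ := a + (1 + k)) _ _
      (by omega) (by omega) (by omega) (by omega), place_strands, glue_idWeb_right, ih]
    rfl

theorem place_cross (n l : ℕ) : ∀ {b N : ℕ} (hm : 0 + (n + l) + b = N) (hn : 0 + (l + n) + b = N),
    place 0 b hm hn (bracket (cross n l)) = toW (bundle (gen N) n l) := by
  induction l with
  | zero =>
    intro b N hm hn
    change place 0 b hm hn (Finsupp.single (strandsWeb _) 1) = _
    rw [place_strandsWeb]
    rfl
  | succ l ih =>
    intro b N hm hn
    change place 0 b hm hn (glue (glue (stack (bracket (cross n l)) (bracket (strands 1)))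
      (stack (bracket (strands l)) (bracket (crossOne n)))) (Finsupp.single (strandsWeb _) 1)) = _
    rw [place_glue 0 b (N' := N) hm (by omega) hn, place_strandsWeb, glue_strandsWeb_right,
      place_zero_zero, place_glue 0 b (N' := N) hm (by omega) (by omega),
      place_stack 0 b (m := n + l) (n := l + n) (m' := 1) (n' := 1) (N' := N) (b₁ := 1 + b)
      (a₂ := l + n) _ _
      (by omega) (by omega) (by omega) (by omega), place_strands, glue_idWeb_right, ih,
      place_stack 0 b (m := l) (n := l) (m' := n + 1) (n' := 1 + n) (N' := N) (b₁ := n + 1 + b)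
      (a₂ := l) _ _
      (by omega) (by omega) (by omega) (by omega), place_strands, glue_idWeb_left, place_crossOne]
    rfl

/-- The two recursions agree once added strands are absorbed into `place`; the shift by `a` covers
both the upper and the lower clasp. -/
theorem place_clasp : ∀ (k : ℕ) {a b N : ℕ} (hm hn : a + k + b = N),
    place a b hm hn (clasp k) = toW (jw (fun i => gen N (a + i)) k)
  | 0, _, _, _, hm, hn => place_strands hm hn
  | 1, _, _, _, hm, hn => place_strands hm hn
  | k + 2, a, b, N, hm, hn => by
    have hp : place a b hm hn (stack (clasp (k + 1)) (bracket (strands 1))) =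
        toW (jw (fun i => gen N (a + i)) (k + 1)) := by
      rw [place_stack a b (m := k + 1) (n := k + 1) (m' := 1) (n' := 1) (N' := N) (b₁ := 1 + b)
        (a₂ := a + (k + 1)) _ _
        (by omega) (by omega) (by omega) (by omega), place_strands, glue_idWeb_right,
        place_clasp (k + 1)]
    have he : place a b hm hn (bracket ((strands k).vcomp (Tangle.cap.hcomp .cup))) =
        toW (gen N (a + k)) := by
      change place a b hm hn (stack (bracket (strands k)) (glue (bracket .cap) (bracket .cup))) = _
      rw [place_stack a b (N' := N) (b₁ := 2 + b) (a₂ := a + k) hm hn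
        (by omega) (by omega) (by omega) (by omega), place_strands, glue_idWeb_left, place_cap_cup]
    rw [clasp, map_add, map_smul, place_glue a b hm hm hn, place_glue a b hm hm hm, hp, he]
    rfl

end A1Web

end

noncomputable section

namespace A1Web

open TL

/-! ### Turnbacks -/

/-- The extra top generator of each row commutes with the preceding narrower rows, so these
generators collect on the left in ascending order. -/
theorem TLRel.rows_succ_width {A : Type*} [Ring A] [Algebra K A] {N : ℕ} {e : ℕ → A}
    (h : TLRel N e) (p a j : ℕ) : rows e p (a + 1) j = asc e (p + a) j * rows e p a j := by
  induction j with
  | zero => simp [rows, asc]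
  | succ j ih =>
    have c : Commute (e (p + a + j)) (rows e p a j) :=
      commute_rows fun i _ _ => (h.comm _ _ (by omega)).symm
    calc _ = asc e (p + a) j * (rows e p a j * e (p + a + j)) * desc e (p + j) a := by
          rw [rows, ih, desc, show p + j + a = p + a + j by omega]
          simp only [mul_assoc]
      _ = _ := by
          rw [← c.eq, asc, rows]
          simp only [mul_assoc]

theorem capAt_eq {N M i : ℕ} (h : N = M + 2) (hi : i + 1 ≤ M) :
    capAt N M i h (by omega) = glue (toW (gen N i)) (capAt N M (i + 1) h hi) := by
  rw [gen_eq h (by omega), glue_assoc, cupAt_capAt_succ, glue_idWeb_right]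

theorem cupAt_eq {N M i : ℕ} (h : N = M + 2) (hi : i + 1 ≤ M) :
    cupAt N M i h (by omega) = glue (cupAt N M (i + 1) h hi) (toW (gen N i)) := by
  rw [gen_eq h (by omega), ← glue_assoc, cupAt_succ_capAt, glue_idWeb_left]

theorem capAt_eq_asc {N M i : ℕ} (h : N = M + 2) (s : ℕ) (hi : i + s ≤ M) :
    capAt N M i h (by omega) = glue (toW (asc (gen N) i s)) (capAt N M (i + s) h hi) := by
  induction s with
  | zero => exact (glue_idWeb_left _).symm
  | succ s ih =>
    rw [ih (by omega), asc, toW_mul, glue_assoc, capAt_eq (i := i + s) h hi]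
    rfl

theorem cupAt_eq_desc {N M i : ℕ} (h : N = M + 2) (s : ℕ) (hi : i + s ≤ M) :
    cupAt N M i h (by omega) = glue (cupAt N M (i + s) h hi) (toW (desc (gen N) i s)) := by
  induction s with
  | zero => exact (glue_idWeb_right _).symm
  | succ s ih =>
    rw [ih (by omega), desc, toW_mul, ← glue_assoc, cupAt_eq (i := i + s) h hi]
    rfl

theorem capAt_cupAt {N M i : ℕ} (h : N = M + 2) (s : ℕ) (hi : i + s ≤ M) :
    glue (capAt N M (i + s) h hi) (cupAt N M i h (by omega)) =
      toW (desc (gen N) i (s + 1)) := by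
  rw [cupAt_eq_desc h s hi, ← glue_assoc, ← gen_eq, desc, toW_mul]

theorem capAt_gen {N M c i : ℕ} (h : N = M + 2) (hc : c ≤ M) (hi : i + 2 ≤ c) :
    glue (capAt N M c h hc) (toW (gen M i)) = glue (toW (gen N i)) (capAt N M c h hc) := by
  rw [gen, dif_pos (by omega), gen, dif_pos (by omega), toW_ofW, toW_ofW]
  exact (place_comm _ _ _ _ _ _ _ _ (by omega) _ _).symm

theorem cupAt_gen {N M c i : ℕ} (h : N = M + 2) (hc : c ≤ M) (hi : i + 2 ≤ c) :
    glue (cupAt N M c h hc) (toW (gen N i)) = glue (toW (gen M i)) (cupAt N M c h hc) := by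
  rw [gen, dif_pos (by omega), gen, dif_pos (by omega), toW_ofW, toW_ofW]
  exact (place_comm _ _ _ _ _ _ _ _ (by omega) _ _).symm

theorem capAt_desc {N M c p k : ℕ} (h : N = M + 2) (hc : c ≤ M) (hk : p + k + 1 ≤ c) :
    glue (capAt N M c h hc) (toW (desc (gen M) p k)) =
      glue (toW (desc (gen N) p k)) (capAt N M c h hc) := by
  induction k with
  | zero => exact (glue_idWeb_right _).trans (glue_idWeb_left _).symm
  | succ k ih =>
    rw [desc, toW_mul, ← glue_assoc, capAt_gen h hc (by omega), glue_assoc, ih (by omega),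
      ← glue_assoc, ← toW_mul]
    rfl

theorem capAt_rows {N M c p a j : ℕ} (h : N = M + 2) (hc : c ≤ M) (hk : p + a + j ≤ c) :
    glue (capAt N M c h hc) (toW (rows (gen M) p a j)) =
      glue (toW (rows (gen N) p a j)) (capAt N M c h hc) := by
  induction j with
  | zero => exact (glue_idWeb_right _).trans (glue_idWeb_left _).symm
  | succ j ih =>
    rw [rows, toW_mul, ← glue_assoc, ih (by omega), glue_assoc, capAt_desc h hc (by omega),
      ← glue_assoc, ← toW_mul]
    rfl

theorem cupAt_jw {N M c : ℕ} (h : N = M + 2) (hc : c ≤ M) : ∀ k, k ≤ c →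
    glue (cupAt N M c h hc) (toW (jw (gen N) k)) =
      glue (toW (jw (gen M) k)) (cupAt N M c h hc)
  | 0, _ => (glue_idWeb_right _).trans (glue_idWeb_left _).symm
  | 1, _ => (glue_idWeb_right _).trans (glue_idWeb_left _).symm
  | k + 2, hk => by
    have ih := cupAt_jw h hc (k + 1) (by omega)
    have hg := cupAt_gen h hc hk
    have key : glue (cupAt N M c h hc) (toW (jw (gen N) (k + 1) * gen N k * jw (gen N) (k + 1))) =
        glue (toW (jw (gen M) (k + 1) * gen M k * jw (gen M) (k + 1))) (cupAt N M c h hc) := by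
      rw [toW_mul, toW_mul, ← glue_assoc, ← glue_assoc, ih, glue_assoc _ _ (toW (gen N k)), hg,
        ← glue_assoc, glue_assoc _ _ (toW (jw (gen N) _)), ih, ← glue_assoc, ← toW_mul, ← toW_mul]
    simp only [jw, map_add, map_smul, LinearMap.add_apply, LinearMap.smul_apply, ih, key]

theorem bracket_caps_succ (j : ℕ) : bracket (caps (j + 1)) =
    glue (place j j (by omega) (by omega) (bracket .cap) : W ((j + 1) + (j + 1)) (j + j))
      (bracket (caps j)) := by
  change glue (Finsupp.single (strandsWeb _) 1)
    (glue (stack (stack (bracket (strands j)) (bracket .cap)) (bracket (strands j)))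
      (bracket (caps j))) = _
  rw [← glue_assoc, glue_strandsWeb_left, stack_strands_strands, place_place]
  congr 2
  exact place_congr (by omega) (by omega) _ _ _

theorem bracket_cups_succ (j : ℕ) : bracket (cups (j + 1)) =
    glue (bracket (cups j))
      (place j j (by omega) (by omega) (bracket .cup) : W (j + j) ((j + 1) + (j + 1))) := by
  change glue (glue (bracket (cups j))
    (stack (stack (bracket (strands j)) (bracket .cup)) (bracket (strands j))))
    (Finsupp.single (strandsWeb _) 1) = _
  rw [glue_assoc, glue_strandsWeb_right, stack_strands_strands, place_place]
  congr 1
  exact place_congr (by omega) (by omega) _ _ _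

/-- The innermost cap is first moved `j` places down, at the cost of an ascending word, so that it
can slide past the rows given by induction. There it meets the innermost cup and leaves the last
descending row, while the ascending word widens the other rows by one. -/
theorem place_caps_cups (j : ℕ) : ∀ {a b N : ℕ} (hm hn : a + (j + j) + b = N),
    place a b hm hn (glue (bracket (caps j)) (bracket (cups j))) =
      toW (rows (gen N) a j j) := by
  induction j with
  | zero =>
    intro a b N hm hn
    change place a b hm hn (glue (idWeb 0) (bracket (strands 0))) = _
    rw [glue_idWeb_left, place_strands]
    rfl
  | succ j ih =>
    intro a b N hm hn
    have hM : a + (j + j) + b + 2 = N := by omega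
    obtain ⟨M, hM', hM⟩ : ∃ M, a + (j + j) + b = M ∧ N = M + 2 := ⟨_, rfl, hM.symm⟩
    have hc : place a b hm hM' (place j j (by omega) (by omega) (bracket .cap) :
        W ((j + 1) + (j + 1)) (j + j)) = capAt N M (a + j) hM (by omega) := by
      rw [place_place]
      exact place_congr (by omega) (by omega) _ _ _
    have hu : place a b hM' hm (place j j (by omega) (by omega) (bracket .cup) :
        W (j + j) ((j + 1) + (j + 1))) = cupAt N M (a + j) hM (by omega) := by
      rw [place_place]
      exact place_congr (by omega) (by omega) _ _ _
    rw [bracket_caps_succ, bracket_cups_succ, glue_assoc, ← glue_assoc (bracket (caps j)),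
      place_glue a b hm hM' hn, place_glue a b hM' hM' hn, ih, hc, hu,
      capAt_eq_asc hM j (by omega), glue_assoc, ← glue_assoc (capAt _ _ _ _ _),
      capAt_rows hM (by omega) (by omega), glue_assoc, capAt_cupAt, ← toW_mul, ← toW_mul, rows,
      (tlRel_gen N).rows_succ_width, mul_assoc]

theorem bracket_turnback (n : ℕ) (k : Fin (n + 1)) :
    bracket (turnback n k) = toW (rows (gen (n + n)) k (n - k) (n - k)) := by
  have hk : (k : ℕ) ≤ n := Nat.lt_succ_iff.1 k.2
  change glue (glue (Finsupp.single (strandsWeb _) 1)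
    (stack (stack (bracket (strands k)) (glue (bracket (caps (n - k))) (bracket (cups (n - k)))))
      (bracket (strands k)))) (Finsupp.single (strandsWeb _) 1) = _
  rw [glue_strandsWeb_left, glue_strandsWeb_right, stack_strands_strands, place_place, place_place,
    ← place_caps_cups (n - k) (a := k) (b := k) (by omega) (by omega)]
  exact place_congr (by omega) (by omega) _ _ _

/-! ### The crossing of two clasped bundles of webs -/

theorem commute_jw_of {A : Type*} [Ring A] [Algebra K A] {e : ℕ → A} {x : A} : ∀ {k : ℕ},
    (∀ i, i + 2 ≤ k → Commute x (e i)) → Commute x (jw e k)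
  | 0, _ => Commute.one_right _
  | 1, _ => Commute.one_right _
  | k + 2, h => by
    have h1 : Commute x (jw e (k + 1)) := commute_jw_of fun i hi => h i (by omega)
    exact h1.add_right (((h1.mul_right (h k le_rfl)).mul_right h1).smul_right _)

/-- Two clasps, one above the other. -/
def twoClasps (n : ℕ) : TL (n + n) :=
  jw (gen (n + n)) n * jw (fun i => gen (n + n) (n + i)) n

theorem stack_clasp_clasp (n : ℕ) : stack (clasp n) (clasp n) = toW (twoClasps n) := by
  rw [stack_eq_glue, place_clasp, place_clasp, ← toW_mul]
  simp only [zero_add, twoClasps]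

/-- Every generator except `e_{n-1}`, which joins the two bundles, lies within one of the clasps. -/
theorem twoClasps_mul_gen {n m : ℕ} (h1 : m + 1 ≠ n) (h2 : m + 2 ≤ 2 * n) :
    twoClasps n * gen (n + n) m = 0 := by
  have h := tlRel_gen (n + n)
  rcases Nat.lt_or_gt_of_ne h1 with h3 | h3
  · have c : Commute (gen (n + n) m) (jw (fun i => gen (n + n) (n + i)) n) :=
      commute_jw_of fun i _ => h.comm _ _ (by omega)
    rw [twoClasps, mul_assoc, ← c.eq, ← mul_assoc, h.jw_mul (by omega), zero_mul]
  · obtain ⟨i, rfl⟩ := Nat.exists_eq_add_of_le (show n ≤ m by omega)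
    rw [twoClasps, mul_assoc, (h.shift n).jw_mul (by omega), mul_zero]

theorem gen_mul_twoClasps {n m : ℕ} (h1 : m + 1 ≠ n) (h2 : m + 2 ≤ 2 * n) :
    gen (n + n) m * twoClasps n = 0 := by
  have h := tlRel_gen (n + n)
  rcases Nat.lt_or_gt_of_ne h1 with h3 | h3
  · rw [twoClasps, ← mul_assoc, h.mul_jw (by omega), zero_mul]
  · obtain ⟨i, rfl⟩ := Nat.exists_eq_add_of_le (show n ≤ m by omega)
    have c : Commute (gen (n + n) (n + i)) (jw (gen (n + n)) n) :=
      commute_jw_of fun i _ => (h.comm _ _ (by omega)).symm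
    have h4 := (h.shift n).mul_jw (k := n) (m := i) (by omega)
    rw [twoClasps, ← mul_assoc, c.eq, mul_assoc, h4, mul_zero]

theorem clasped_eq {n : ℕ} {D : Tangle (n + n) (n + n)} {x : TL (n + n)}
    (h : bracket D = toW x) : clasped n D = toW (twoClasps n * x * twoClasps n) := by
  rw [clasped, h, stack_clasp_clasp, ← toW_mul, ← toW_mul]

theorem clasped_cross (n : ℕ) : clasped n (cross n n) = ∑ k : Fin (n + 1),
    (t ^ (-(n : ℤ) ^ 2 + 2 * ((k : ℕ) : ℤ) ^ 2) * qBinom n k) • clasped n (turnback n k) := by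
  have h1 : bracket (cross n n) = toW (bundle (gen (n + n)) n n) := by
    rw [← place_cross n n (b := 0) (by omega) (by omega), place_zero_zero]
  have h2 : TLRel (2 * n) (gen (n + n)) := two_mul n ▸ tlRel_gen (n + n)
  rw [clasped_eq h1, h2.crossing (fun m => twoClasps_mul_gen) (fun m => gen_mul_twoClasps), map_sum]
  refine Finset.sum_congr rfl fun k _ => ?_
  rw [map_smul, clasped_eq (bracket_turnback n k)]

/-! ### The colored loop -/

/-- The last clause of `TLRel.jw_spec` is enclosed between a cup and a cap. Each side then acquires
two loops, and the nonzero factor `[2] ^ 2` is cancelled. -/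
theorem cupAt_jw_capAt {N M k : ℕ} (h : N = M + 2) (hk : k ≤ M) :
    glue (cupAt N M k h hk) (glue (toW (jw (gen N) (k + 1))) (capAt N M k h hk)) =
      (-(qInt (k + 2) / qInt (k + 1))) • toW (jw (gen M) k) := by
  have hd : -qInt 2 ≠ 0 := neg_ne_zero.2 (by exact_mod_cast qInt_ne_zero two_ne_zero)
  have h5 := congrArg toW ((tlRel_gen N).jw_spec k).2.2.2.2
  rw [toW_mul, toW_mul, gen_eq h hk, map_smul, toW_mul, gen_eq h hk] at h5
  have h6 := congrArg (fun z => glue (glue (cupAt N M k h hk) z) (capAt N M k h hk)) h5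
  simp only [glue_assoc, map_smul, LinearMap.smul_apply] at h6
  rw [← glue_assoc (cupAt N M k h hk) (capAt N M k h hk), cupAt_capAt_self] at h6
  rw [← glue_assoc (cupAt N M k h hk) (toW (jw (gen N) k)), cupAt_jw h hk k le_rfl] at h6
  simp only [glue_assoc, map_smul, LinearMap.smul_apply, glue_idWeb_left, glue_idWeb_right] at h6
  rw [cupAt_capAt_self] at h6
  simp only [map_smul, glue_idWeb_right] at h6
  rw [smul_smul, smul_comm _ (-qInt 2), smul_comm _ (-qInt 2), smul_smul] at h6
  exact smul_right_injective _ (mul_ne_zero hd hd) h6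

theorem coloredLoop_eq (n : ℕ) : coloredLoop n =
    glue (glue (bracket (cups n)) (toW (jw (gen (n + n)) n))) (bracket (caps n)) := by
  rw [coloredLoop, stack_eq_glue, place_strands, glue_idWeb_right, place_clasp]
  simp only [zero_add]

/-- The innermost cup and cap close the last strand of the clasp, leaving a smaller colored loop;
the denominator of the new factor cancels the previous quantum integer. -/
theorem coloredLoop_eq_smul (n : ℕ) :
    coloredLoop n = ((-1) ^ n * qInt ((n : ℤ) + 1)) • emptyDisk := by
  induction n with
  | zero =>
    rw [coloredLoop_eq]
    change glue (glue (idWeb 0) (idWeb 0)) (idWeb 0) = _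
    rw [glue_idWeb_left, glue_idWeb_left]
    simp [qInt_one, idWeb, emptyDisk]
  | succ n ih =>
    have hN : (n + 1) + (n + 1) = (n + n) + 2 := by omega
    have hc : (place n n (by omega) (by omega) (bracket .cap) :
        W ((n + 1) + (n + 1)) (n + n)) = capAt _ _ n hN (by omega) :=
      place_congr rfl (by omega) _ _ _
    have hu : (place n n (by omega) (by omega) (bracket .cup) :
        W (n + n) ((n + 1) + (n + 1))) = cupAt _ _ n hN (by omega) :=
      place_congr rfl (by omega) _ _ _
    have hq : qInt ((n : ℤ) + 1) ≠ 0 := by exact_mod_cast qInt_ne_zero (Nat.succ_ne_zero n)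
    rw [coloredLoop_eq, bracket_caps_succ, bracket_cups_succ, hc, hu, ← glue_assoc,
      glue_assoc (bracket (cups n)), glue_assoc (bracket (cups n)), glue_assoc (cupAt _ _ _ _ _),
      cupAt_jw_capAt, map_smul, map_smul, LinearMap.smul_apply, ← coloredLoop_eq, ih, smul_smul]
    congr 1
    push_cast
    rw [show (n : ℤ) + 1 + 1 = n + 2 by ring]
    field_simp
    ring

end A1Web

end

theorem mainTheorem8 (n : ℕ) :
    (A1Web.clasped n (A1Web.cross n n) =
      ∑ k : Fin (n + 1),
        (A1Web.t ^ (-(n : ℤ) ^ 2 + 2 * ((k : ℕ) : ℤ) ^ 2) * A1Web.qBinom n k) •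
          A1Web.clasped n (A1Web.turnback n k)) ∧
    A1Web.coloredLoop n = ((-1) ^ n * A1Web.qInt ((n : ℤ) + 1)) • A1Web.emptyDisk :=
  ⟨A1Web.clasped_cross n, A1Web.coloredLoop_eq_smul n⟩
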